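/- **Modified multipole expansion of the Yukawa potential.** Let $\lambda>0$, $R>0$, $\tau\in\mathbb R^3$, and let $\bar B_R(\tau)\subset\mathbb R^3$ be the closed ball of centre $\tau$ and radius $R$. A charge density localized in $\bar B_R(\tau)$ is an integrable function $\rho:\mathbb R^3\to\mathbb C$ that vanishes outside $\bar B_R(\tau)$. Its Yukawa potential, defined through the free-space Green function of $(\Delta-\lambda^2)V=-4\pi\rho$, is $$V[\rho](\mathbf r)=\int_{\mathbb R^3}\frac{e^{-\lambda|\mathbf r-\tau-\mathbf y|}}{|\mathbf r-\tau-\mathbf y|}\,\rho(\mathbf y+\tau)\,d\mathbf y .$$ Let $L=(\ell,m)$ run over all pairs of integers with $\ell\ge 0$, $-\ell\le m\le\ell$; let $Y_L$ be the complex orthonormal spherical harmonics, $\hat{\mathbf x}=\mathbf x/|\mathbf x|$, and let $$i_\ell(x)=\frac{x^\ell}{(2\ell+1)!!}\sum_{s=0}^\infty\frac{(x/2)^{2s}}{s!\,(\ell+\frac32)_s},\qquad k_\ell(x)=\frac{e^{-x}}{x}\sum_{s=0}^{\ell}\frac{(\ell+s)!}{s!\,(\ell-s)!}(2x)^{-s}$$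 be the modified spherical Bessel functions of the first and second kind, where $(a)_s=a(a+1)\cdots(a+s-1)$. The modified multipole moments of $\rho$ are $$q_L[\rho]=\frac{(2\ell+1)!!}{\lambda^\ell}\int_{|\mathbf y|\le R}\rho(\mathbf y+\tau)\,i_\ell(\lambda|\mathbf y|)\,\overline{Y_L(\hat{\mathbf y})}\,d\mathbf y .$$ 1. If $\rho$ is a charge density localized in $\bar B_R(\tau)$, then the integrals defining all $q_L[\rho]$ converge absolutely, and for every $\mathbf r$ with $|\mathbf r-\tau|>R$ the integral defining $V[\rho](\mathbf r)$ converges absolutely and, with $\mathbf x=\mathbf r-\tau$, $$V[\rho](\mathbf r)=\sum_L\frac{4\pi\lambda^{\ell+1}}{(2\ell+1)!!}\,q_L[\rho]\,k_\ell(\lambda|\mathbf x|)\,Y_L(\hat{\mathbf x}),$$ where the series converges unconditionally. 2. If $\rho_1$ and $\rho_2$ are charge densities localized in $\bar B_R(\tau)$ with $q_L[\rho_1]=q_L[\rho_2]$ for all $L$, then $V[\rho_1](\mathbf r)=V[\rho_2](\mathbf r)$ for every $\mathbf r$ with $|\mathbf r-\tau|>R$. -/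

import Mathlib

open MeasureTheory Metric
open scoped Nat

noncomputable section

namespace Yukawa

/-- Euclidean three-space. -/
abbrev E3 : Type := EuclideanSpace ℝ (Fin 3)

/-- The modified spherical Bessel function of the first kind,
`i_ℓ(x) = x^ℓ / (2ℓ+1)!! * ∑_s (x/2)^(2s) / (s! (ℓ+3/2)_s)`, where `(a)_s` is the Pochhammer
symbol; for example `i_0(x) = sinh x / x`. -/
def besselI (l : ℕ) (x : ℝ) : ℝ :=
  x ^ l / ((2 * l + 1)‼ : ℝ) *
    ∑' s : ℕ, (x / 2) ^ (2 * s) / ((s ! : ℝ) * (ascPochhammer ℝ s).eval ((l : ℝ) + 3 / 2))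

/-- The modified spherical Bessel function of the second kind,
`k_ℓ(x) = (e^(-x) / x) * ∑_{s ≤ ℓ} (ℓ+s)! / (s! (ℓ-s)!) * (2x)^(-s) = √(2/(π x)) K_{ℓ+1/2}(x)`,
for `x > 0`. This is the normalization with `k_0(x) = e^(-x) / x`, for which the Wronskian of
`i_ℓ` and `k_ℓ` is `-1/x²`. -/
def besselK (l : ℕ) (x : ℝ) : ℝ :=
  Real.exp (-x) / x *
    ∑ s ∈ Finset.range (l + 1),
      ((l + s)! : ℝ) / ((s ! : ℝ) * ((l - s)! : ℝ)) * ((2 * x) ^ s)⁻¹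

/-- The Legendre polynomial `P_ℓ`, by Rodrigues' formula. -/
def legendre (l : ℕ) : Polynomial ℝ :=
  Polynomial.C (1 / (2 ^ l * (l ! : ℝ))) *
    Polynomial.derivative^[l] ((Polynomial.X ^ 2 - 1) ^ l)

/-- The spherical harmonic `Y_{ℓm}` of order `0 ≤ m ≤ ℓ` at a unit vector
`u = (sin θ cos φ, sin θ sin φ, cos θ)`:
`Y_{ℓm} = √((2ℓ+1)/(4π) * (ℓ-m)!/(ℓ+m)!) P_ℓ^m(cos θ) e^(imφ)`, where
`P_ℓ^m(cos θ) = (-1)^m (sin θ)^m (d^m P_ℓ/dz^m)(cos θ)`. Here `cos θ = u 2` and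
`(sin θ)^m e^(imφ) = (u 0 + i u 1)^m`. -/
def harmonicNonneg (l m : ℕ) (u : E3) : ℂ :=
  (-1) ^ m *
    (Real.sqrt ((2 * l + 1) / (4 * Real.pi) * (((l - m)! : ℝ) / ((l + m)! : ℝ))) : ℂ) *
    (((Polynomial.derivative^[m] (legendre l)).eval (u 2) : ℝ) : ℂ) *
    ((u 0 : ℂ) + Complex.I * (u 1 : ℂ)) ^ m

/-- The (complex, orthonormal) spherical harmonic `Y_{ℓm}` of degree `ℓ` and order `m`,
`-ℓ ≤ m ≤ ℓ`, at a unit vector `u`; negative orders are given by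
`Y_{ℓ,-m} = (-1)^m conj Y_{ℓm}`. -/
def sphericalHarmonic (l : ℕ) (m : ℤ) (u : E3) : ℂ :=
  if 0 ≤ m then harmonicNonneg l m.natAbs u
  else (-1) ^ m.natAbs * (starRingEnd ℂ) (harmonicNonneg l m.natAbs u)

/-- The index set of all `L = (ℓ, m)` with `-ℓ ≤ m ≤ ℓ`. -/
abbrev Index : Type := {p : ℕ × ℤ // |p.2| ≤ (p.1 : ℤ)}

/-- The unit vector `r̂ = r / |r|`. -/
def unitVec (x : E3) : E3 := ‖x‖⁻¹ • x

/-- The free-space Green function `e^(-λ|x-y|) / |x-y|` of `(Δ - λ²) V = -4πρ`. -/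
def green (lam : ℝ) (x y : E3) : ℝ := Real.exp (-(lam * ‖x - y‖)) / ‖x - y‖

/-- An (integrable) charge density localized in the sphere of centre `τ` and radius `R`. -/
structure IsLocalizedCharge (τ : E3) (R : ℝ) (ρ : E3 → ℂ) : Prop where
  integrable : Integrable ρ
  support_subset : Function.support ρ ⊆ closedBall τ R

/-- The integrand, in the variable `y` relative to the centre `τ`, of the Yukawa potential
at `r`. -/
def potentialIntegrand (lam : ℝ) (τ : E3) (ρ : E3 → ℂ) (r y : E3) : ℂ :=
  (green lam (r - τ) y : ℂ) * ρ (y + τ)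

/-- The Yukawa potential of `ρ` at `r`. -/
def potential (lam : ℝ) (τ : E3) (ρ : E3 → ℂ) (r : E3) : ℂ :=
  ∫ y : E3, potentialIntegrand lam τ ρ r y

/-- The integrand of the modified multipole moments. -/
def momentIntegrand (lam : ℝ) (τ : E3) (ρ : E3 → ℂ) (L : Index) (y : E3) : ℂ :=
  ρ (y + τ) * (besselI L.1.1 (lam * ‖y‖) : ℂ) *
    (starRingEnd ℂ) (sphericalHarmonic L.1.1 L.1.2 (unitVec y))

/-- The modified multipole moment
`q_L[ρ] = ((2ℓ+1)!!/λ^ℓ) ∫_{|y| ≤ R} ρ(y+τ) i_ℓ(λ|y|) conj Y_L(ŷ) dy`. -/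
def moment (lam : ℝ) (τ : E3) (R : ℝ) (ρ : E3 → ℂ) (L : Index) : ℂ :=
  (((2 * L.1.1 + 1)‼ : ℂ) / (lam : ℂ) ^ L.1.1) *
    ∫ y in closedBall (0 : E3) R, momentIntegrand lam τ ρ L y

/-- The term of index `L` of the modified multipole expansion with coefficients `q`, at the
position `x` relative to the centre. -/
def multipoleTerm (lam : ℝ) (q : Index → ℂ) (x : E3) (L : Index) : ℂ :=
  4 * (Real.pi : ℂ) * (lam : ℂ) ^ (L.1.1 + 1) / ((2 * L.1.1 + 1)‼ : ℂ) * q L *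
    (besselK L.1.1 (lam * ‖x‖) : ℂ) * sphericalHarmonic L.1.1 L.1.2 (unitVec x)

end Yukawa

end

noncomputable section

namespace Yukawa

/-! For fixed `|x|` and `|y|` the Green function depends only on the cosine `t` of the angle between
`x` and `y`: it is `λ e^(-w)/w`, with `w²` affine in `t`. Its Legendre coefficients come from
Rodrigues' formula and `l` integrations by parts. Each `t`-derivative raises the index of `sqK` by
one, so what remains is the integral of `k_l(w)/w^l` against `(1 - t²)^l`. `integral_pow_mul_sqK`
shows that this integral factors into a function of `|y|` times a function of `|x|`, by induction on
`l` with a differentiation in each radius. The series `∑ (2l+1) i_l k_l P_l` is dominated by a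
geometric series of ratio `|y|/|x|`, so its sum is continuous in `t` and has the same Legendre
coefficients as the kernel. Completeness of the Legendre polynomials identifies the two in
`hasSum_yukawa_legendre`.

The addition theorem `sum_sphericalHarmonic_mul_conj` then splits `P_l` into spherical harmonics.
Its proof is algebraic. A unit vector `u` is encoded by the quadratic `(u₀ + i u₁) X² + 2 u₂ X - (u₀
- i u₁)`, whose discriminant is the same for all `u`. The coefficients of its `l`-th power are the
`Y_{lm}(u)` up to normalization, and an invariant pairing of binary forms of degree `2l` turns the
sum over `m` into `P_l(u·v)`.

Taking `u = v` bounds the harmonics, so the expansion of the kernel converges absolutely, with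
bounds uniform in `y` on the ball minus the origin. It can therefore be integrated termwise against
`ρ`. The resulting series sees `ρ` only through its moments, which gives the second claim. -/

/-! ### Powers of quadratic forms and associated Legendre functions. -/

open Polynomial in
/-- The quadratic polynomial `a X² + 2 z X - b`. -/
def quadPoly (a z b : ℂ) : Polynomial ℂ := C a * X ^ 2 + C (2 * z) * X - C b

lemma natDegree_quadPoly_le (a z b : ℂ) : (quadPoly a z b).natDegree ≤ 2 := by
  unfold quadPoly
  compute_degree

-- The substitution `X ↦ a X` normalizes the leading coefficient. It degenerates at `a = 0`, where
-- the form has degree at most one and the coefficients are read off directly.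
open Polynomial in
lemma coeff_quadPoly_pow_add (a z b : ℂ) (l m : ℕ) :
    ((quadPoly a z b) ^ l).coeff (l + m) =
      a ^ m * ((quadPoly 1 z (a * b)) ^ l).coeff (l + m) := by
  rcases eq_or_ne a 0 with rfl | ha
  · have h1 : quadPoly 0 z b = C (2 * z) * X + C (-b) := by simp [quadPoly, sub_eq_add_neg]
    have h2 : quadPoly 1 z (0 * b) = X * (X + C (2 * z)) := by simp [quadPoly]; ring
    have h3 : (C (2 * z) * X + C (-b)).natDegree ≤ 1 := by compute_degree
    rcases Nat.eq_zero_or_pos m with rfl | hm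
    · rw [h1, h2, mul_pow, add_zero]
      have := coeff_X_pow_mul ((X + C (2 * z)) ^ l) l 0
      rw [zero_add] at this
      rw [this]
      have h4 := coeff_pow_of_natDegree_le (m := l) h3
      rw [mul_one] at h4
      rw [h4]
      simp [coeff_zero_eq_eval_zero]
    · rw [h1, zero_pow hm.ne', zero_mul]
      apply coeff_eq_zero_of_natDegree_lt
      calc _ ≤ l * 1 := natDegree_pow_le_of_le l h3
        _ < l + m := by omega
  · have h : (quadPoly 1 z (a * b)).comp (C a * X) = C a * quadPoly a z b := by
      simp [quadPoly]; ring
    have h2 := congrArg (fun p => (p ^ l).coeff (l + m)) h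
    simp only [← pow_comp, mul_pow, ← C_pow, comp_C_mul_X_coeff, coeff_C_mul] at h2
    have : a ^ l ≠ 0 := pow_ne_zero _ ha
    apply mul_left_cancel₀ this
    rw [← h2]; ring

lemma iterate_derivative_legendre_eval (l m : ℕ) (z : ℝ) :
    (Polynomial.derivative^[l + m] ((Polynomial.X ^ 2 - 1 : Polynomial ℝ) ^ l)).eval z =
      2 ^ l * (l ! : ℝ) * (Polynomial.derivative^[m] (legendre l)).eval z := by
  rw [legendre, Polynomial.iterate_derivative_C_mul, Polynomial.eval_mul, Polynomial.eval_C,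
    ← Function.iterate_add_apply, add_comm m l]
  have : (l ! : ℝ) ≠ 0 := by positivity
  field_simp

open Polynomial in
/-- Taylor's formula for `((X + z)² - 1)^l`: the coefficients of `(a X² + 2 z X - b)^l` with
`a b = 1 - z²` are associated Legendre functions. -/
lemma coeff_quadPoly_pow_high {a b : ℂ} {z : ℝ} (h : a * b = 1 - (z : ℂ) ^ 2) (l m : ℕ) :
    ((quadPoly a z b) ^ l).coeff (l + m) =
      a ^ m * ((2 ^ l * (l ! : ℝ) / ((l + m)! : ℝ) *
        (derivative^[m] (legendre l)).eval z : ℝ) : ℂ) := by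
  rw [coeff_quadPoly_pow_add, h]
  congr 1
  have h1 : quadPoly 1 z (1 - (z : ℂ) ^ 2) =
      (taylor z (X ^ 2 - 1 : Polynomial ℝ)).map Complex.ofRealHom := by
    have h2 : (C 2 : Polynomial ℂ) = 2 := map_ofNat C 2
    simp [quadPoly, taylor_apply, h2]
    ring
  rw [h1, ← Polynomial.map_pow, coeff_map, ← taylor_pow, taylor_coeff]
  have h2 := congrArg (fun p => p.eval z)
    (congrFun (factorial_smul_hasseDeriv (R := ℝ) (k := l + m)) ((X ^ 2 - 1 : Polynomial ℝ) ^ l))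
  simp only [iterate_derivative_legendre_eval] at h2
  have h3 : ((l + m)! : ℝ) ≠ 0 := by positivity
  rw [Complex.ofRealHom_eq_coe]
  congr 1
  rw [div_mul_eq_mul_div, eq_div_iff h3, ← h2]
  simp [mul_comm]

open Polynomial in
lemma reflect_pow_le (f : Polynomial ℂ) {d : ℕ} (hf : f.natDegree ≤ d) (l : ℕ) :
    reflect (d * l) (f ^ l) = (reflect d f) ^ l := by
  induction l with
  | zero => simp
  | succ l ih =>
    rw [pow_succ, pow_succ, mul_add, mul_one, reflect_mul _ _ _ hf, ih]
    rw [mul_comm]; exact natDegree_pow_le_of_le l hf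

open Polynomial in
lemma reflect_quadPoly (a z b : ℂ) : reflect 2 (quadPoly a z b) = quadPoly (-b) z (-a) := by
  ext i
  rw [coeff_reflect]
  rcases i with _ | _ | _ | i
  · simp [quadPoly, coeff_X, coeff_C]
  · simp [quadPoly, coeff_C]
  · simp [quadPoly, coeff_X, coeff_C]
  · rw [revAt_eq_self_of_lt (by omega)]
    simp [quadPoly]

-- Reversing the coefficients exchanges `a` with `-b`, so the low coefficients are the high
-- coefficients of the reversed form.
open Polynomial in
lemma coeff_quadPoly_pow_low {a b : ℂ} {z : ℝ} (h : a * b = 1 - (z : ℂ) ^ 2) {l m : ℕ}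
    (hm : m ≤ l) :
    ((quadPoly a z b) ^ l).coeff (l - m) =
      (-b) ^ m * ((2 ^ l * (l ! : ℝ) / ((l + m)! : ℝ) *
        (derivative^[m] (legendre l)).eval z : ℝ) : ℂ) := by
  rw [← coeff_quadPoly_pow_high (a := -b) (b := -a) (by rw [← h]; ring), ← reflect_quadPoly,
    ← reflect_pow_le _ (natDegree_quadPoly_le _ _ _), coeff_reflect, revAt_le (by omega)]
  congr 1
  omega

/-! ### The pairing of binary forms. -/

/-- The invariant bilinear pairing of binary forms of degree `n`. -/
def formPairing (n : ℕ) (f g : Polynomial ℂ) : ℂ :=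
  ∑ k ∈ Finset.range (n + 1), f.coeff k * g.coeff k / (n.choose k : ℂ)

-- The outer variable is that of the forms and the inner one a formal parameter. Comparing this
-- expansion with `coeff_linear_pow` for the same polynomial yields `choose_mul_formPairing`.
open Polynomial in
lemma coeff_coeff_add_pow (L M : Polynomial ℂ) (n j k : ℕ) (hj : j ≤ n) :
    (((L.map C + C (X : Polynomial ℂ) * M.map C) ^ n).coeff k).coeff j =
      (n.choose j : ℂ) * (L ^ (n - j) * M ^ j).coeff k := by
  rw [add_comm, add_pow, finsetSum_coeff, finsetSum_coeff, Finset.sum_eq_single j]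
  · rw [mul_pow, ← C_pow, mul_assoc, mul_assoc, coeff_C_mul, ← mul_assoc, ← Polynomial.map_pow,
      ← Polynomial.map_pow, ← Polynomial.map_mul, ← C_eq_natCast, coeff_mul_C, coeff_map]
    have := coeff_X_pow_mul (C ((M ^ j * L ^ (n - j)).coeff k) * (n.choose j : Polynomial ℂ)) j 0
    rw [zero_add] at this
    rw [this, ← C_eq_natCast, ← C_mul, coeff_C_zero]
    simp only [mul_comm]
  · intro i _ hij
    rw [mul_pow, ← C_pow, mul_assoc, mul_assoc, coeff_C_mul, ← mul_assoc, ← Polynomial.map_pow,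
      ← Polynomial.map_pow, ← Polynomial.map_mul, ← C_eq_natCast, coeff_mul_C, coeff_map,
      ← C_eq_natCast, ← C_mul, coeff_X_pow_mul']
    split_ifs with h
    · rw [coeff_C, if_neg (by omega)]
    · rfl
  · intro h
    exact absurd (Finset.mem_range.2 (by omega)) h

open Polynomial in
lemma coeff_linear_pow (σ τ : Polynomial ℂ) (n k : ℕ) :
    ((C σ + C τ * X : Polynomial (Polynomial ℂ)) ^ n).coeff k =
      τ ^ k * σ ^ (n - k) * (n.choose k : Polynomial ℂ) := by
  rw [add_comm, add_pow, finsetSum_coeff]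
  have h : ∀ i, ((C τ * X) ^ i * (C σ) ^ (n - i) * (n.choose i : Polynomial (Polynomial ℂ))) =
      C (τ ^ i * σ ^ (n - i) * (n.choose i : Polynomial ℂ)) * X ^ i := by
    intro i
    simp only [C_mul, C_pow, mul_pow, map_natCast]
    ring
  simp only [h, coeff_C_mul, coeff_X_pow, mul_ite, mul_one, mul_zero]
  rw [Finset.sum_ite_eq]
  split_ifs with hk
  · rfl
  · rw [Nat.choose_eq_zero_of_lt (by simpa using hk)]
    simp

/-- Homogenization of `f`, of formal degree `n`, evaluated at `(τ, σ)`. -/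
def homEval (n : ℕ) (f : Polynomial ℂ) (τ σ : Polynomial ℂ) : Polynomial ℂ :=
  MvPolynomial.aeval ![τ, σ] (f.homogenize n)

open Polynomial in
lemma homEval_eq_sum (n : ℕ) (f τ σ : Polynomial ℂ) :
    homEval n f τ σ = ∑ k ∈ Finset.range (n + 1), C (f.coeff k) * (τ ^ k * σ ^ (n - k)) := by
  rw [homEval, homogenize, map_sum, Finset.Nat.sum_antidiagonal_eq_sum_range_succ_mk]
  refine Finset.sum_congr rfl fun k _ => ?_
  rw [MvPolynomial.aeval_monomial, Finsupp.prod_fintype _ _ (by simp)]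
  simp [Polynomial.algebraMap_eq]

open Polynomial in
lemma homEval_pow (f τ σ : Polynomial ℂ) {d : ℕ} (hf : f.natDegree ≤ d) (l : ℕ) :
    homEval (d * l) (f ^ l) τ σ = (homEval d f τ σ) ^ l := by
  induction l with
  | zero => simp [homEval]
  | succ l ih =>
    rw [pow_succ, pow_succ, ← ih, mul_add, mul_one, homEval, homogenize_mul _ _ _ hf, map_mul]
    · rfl
    · rw [mul_comm]; exact natDegree_pow_le_of_le l hf

open Polynomial in
lemma homEval_quadPoly (a z b : ℂ) (τ σ : Polynomial ℂ) :
    homEval 2 (quadPoly a z b) τ σ = C a * τ ^ 2 + C (2 * z) * (τ * σ) - C b * σ ^ 2 := by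
  rw [homEval_eq_sum]
  simp [Finset.sum_range_succ, quadPoly, coeff_X, coeff_C]
  ring

open Polynomial in
/-- Pairing with a product of powers of linear forms is a coefficient of an evaluation. -/
lemma choose_mul_formPairing (L M g σ τ : Polynomial ℂ) (n j : ℕ) (hj : j ≤ n)
    (h : L.map C + C (X : Polynomial ℂ) * M.map C = C σ + C τ * X) :
    (n.choose j : ℂ) * formPairing n (L ^ (n - j) * M ^ j) g = (homEval n g τ σ).coeff j := by
  rw [formPairing, homEval_eq_sum, Finset.mul_sum, finsetSum_coeff]
  refine Finset.sum_congr rfl fun k hk => ?_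
  have h1 := coeff_coeff_add_pow L M n j k hj
  rw [h, coeff_linear_pow, ← C_eq_natCast, coeff_mul_C] at h1
  rw [coeff_C_mul]
  have hc : (n.choose k : ℂ) ≠ 0 := by
    exact_mod_cast (Nat.choose_pos (by simpa [Nat.lt_succ_iff] using hk)).ne'
  field_simp
  rw [← h1]
  ring

open Polynomial in
lemma coeff_quadPoly_pow_mid {a b : ℂ} {z : ℝ} (h : a * b = 1 - (z : ℂ) ^ 2) (l : ℕ) :
    ((quadPoly a z b) ^ l).coeff l = 2 ^ l * (((legendre l).eval z : ℝ) : ℂ) := by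
  have := coeff_quadPoly_pow_high h l 0
  rw [add_zero] at this
  rw [this]
  have : (l ! : ℝ) ≠ 0 := by positivity
  rw [mul_div_assoc, div_self this]
  simp

open Polynomial in
/-- The pairing of the `l`-th powers of two quadratic forms of discriminant one is the Legendre
polynomial of their polar form. -/
lemma formPairing_quadPoly {a₁ b₁ a₂ b₂ : ℂ} {z₁ z₂ w : ℝ} (h₁ : a₁ * b₁ = 1 - (z₁ : ℂ) ^ 2)
    (h₀ : a₁ = 0 → b₁ = 0) (h₂ : a₂ * b₂ = 1 - (z₂ : ℂ) ^ 2)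
    (hw : a₁ * a₂ + b₁ * b₂ + 2 * z₁ * z₂ = 2 * w) (l : ℕ) :
    ((2 * l).choose l : ℂ) * formPairing (2 * l) (quadPoly a₁ z₁ b₁ ^ l) (quadPoly a₂ z₂ b₂ ^ l) =
      4 ^ l * (((legendre l).eval w : ℝ) : ℂ) := by
  have hC2 : (C 2 : Polynomial ℂ) = 2 := map_ofNat C 2
  have hC4 : (C 4 : Polynomial ℂ) = 4 := map_ofNat C 4
  rcases eq_or_ne a₁ 0 with rfl | ha
  -- The vector is a pole: its form is `2 z₁ X` with `z₁² = 1`, and only the middle term of the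
  -- pairing survives.
  · have hb := h₀ rfl
    subst hb
    have hq : quadPoly 0 z₁ 0 = C (2 * (z₁ : ℂ)) * X := by simp [quadPoly]
    have hc : ((2 * l).choose l : ℂ) ≠ 0 := by
      exact_mod_cast (Nat.choose_pos (by omega)).ne'
    have hz : (z₁ : ℂ) ^ 2 = 1 := by linear_combination h₁
    have hw' : (w : ℂ) = z₁ * z₂ := by linear_combination -hw / 2
    have hq2 : C (z₁ : ℂ) * quadPoly a₂ z₂ b₂ = quadPoly (z₁ * a₂) w (z₁ * b₂) := by
      rw [hw']; simp [quadPoly]; ring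
    rw [hq, formPairing, Finset.sum_eq_single l]
    · have h3 := coeff_quadPoly_pow_mid (a := z₁ * a₂) (b := z₁ * b₂) (z := w)
        (by rw [hw']; linear_combination (z₁ : ℂ) ^ 2 * h₂ + hz) l
      rw [← hq2, mul_pow, ← C_pow, coeff_C_mul] at h3
      rw [mul_pow, ← C_pow, coeff_C_mul, coeff_X_pow, if_pos rfl]
      field_simp
      rw [mul_pow, mul_assoc, h3, ← mul_assoc, ← mul_pow]
      norm_num
    · intro k _ hk
      rw [mul_pow, ← C_pow, coeff_C_mul, coeff_X_pow, if_neg hk]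
      simp
    · intro h
      exact absurd (Finset.mem_range.2 (by omega)) h
  -- Since `a₁ b₁ = 1 - z₁²`, `a₁` times the first form is `(a₁ X + z₁)² - 1 = L M`. Regrouping `L +
  -- Y M` by powers of `X` gives `σ + τ X`, with the parameter `Y` represented by the variable of
  -- `σ` and `τ`.
  · set L : Polynomial ℂ := C a₁ * X + C ((z₁ : ℂ) - 1) with hL
    set M : Polynomial ℂ := C a₁ * X + C ((z₁ : ℂ) + 1) with hM
    set σ : Polynomial ℂ := C ((z₁ : ℂ) - 1) + X * C ((z₁ : ℂ) + 1) with hσ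
    set τ : Polynomial ℂ := C a₁ * (1 + X) with hτ
    have hLM : C a₁ * quadPoly a₁ z₁ b₁ = L * M := by
      have h3 : C a₁ * C b₁ = C (1 - (z₁ : ℂ) ^ 2) := by rw [← C_mul, h₁]
      rw [hL, hM, quadPoly, mul_sub, h3]
      simp [hC2]
      ring
    have h4 := choose_mul_formPairing L M (quadPoly a₂ z₂ b₂ ^ l) σ τ (2 * l) l (by omega) (by
      rw [hL, hM, hσ, hτ]
      simp
      ring)
    have h5 : formPairing (2 * l) (L ^ (2 * l - l) * M ^ l) (quadPoly a₂ z₂ b₂ ^ l) =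
        a₁ ^ l * formPairing (2 * l) (quadPoly a₁ z₁ b₁ ^ l) (quadPoly a₂ z₂ b₂ ^ l) := by
      have : 2 * l - l = l := by omega
      rw [this, ← mul_pow, ← hLM, mul_pow, ← C_pow, formPairing, formPairing, Finset.mul_sum]
      refine Finset.sum_congr rfl fun k _ => ?_
      rw [coeff_C_mul]
      ring
    set A : ℂ := a₂ * a₁ ^ 2 + 2 * z₂ * a₁ * (z₁ + 1) - b₂ * (z₁ + 1) ^ 2 with hA
    set B : ℂ := -(a₂ * a₁ ^ 2 + 2 * z₂ * a₁ * (z₁ - 1) - b₂ * (z₁ - 1) ^ 2) with hB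
    -- Substituting `(τ, σ)` in the second form gives, up to the factor `2 a₁`, a form whose middle
    -- parameter is the polar value `w`; `h9` says that it is again normalized. The middle
    -- coefficient of its `l`-th power is then `2^l P_l(w)`.
    have h6 : homEval 2 (quadPoly a₂ z₂ b₂) τ σ =
        C (2 * a₁) * quadPoly (A / (2 * a₁)) w (B / (2 * a₁)) := by
      have h7 : C (2 * a₁) * quadPoly (A / (2 * a₁)) w (B / (2 * a₁)) =
          C A * X ^ 2 + C (2 * a₁ * (2 * w)) * X - C B := by
        rw [quadPoly, mul_sub, mul_add, ← mul_assoc, ← mul_assoc, ← C_mul, ← C_mul, ← C_mul,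
          mul_div_cancel₀ _ (by simpa using ha), mul_div_cancel₀ _ (by simpa using ha)]
      have h8 : 2 * a₁ * (2 * w) = 2 * a₂ * a₁ ^ 2 + 4 * z₂ * a₁ * z₁
          + 2 * (1 - (z₁ : ℂ) ^ 2) * b₂ := by
        linear_combination -2 * a₁ * hw + 2 * b₂ * h₁
      rw [homEval_quadPoly, h7, h8, hA, hB, hσ, hτ]
      simp [hC2, hC4]
      ring
    have h9 : A / (2 * a₁) * (B / (2 * a₁)) = 1 - (w : ℂ) ^ 2 := by
      have hA' : A = (2 * a₁ * w - 2 * b₂) + (2 * z₂ * a₁ - 2 * b₂ * z₁) := by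
        rw [hA]; linear_combination a₁ * hw - b₂ * h₁
      have hB' : B = (2 * z₂ * a₁ - 2 * b₂ * z₁) - (2 * a₁ * w - 2 * b₂) := by
        rw [hB]; linear_combination -a₁ * hw + b₂ * h₁
      rw [div_mul_div_comm, div_eq_iff (by simpa using ha), hA', hB']
      linear_combination 4 * b₂ ^ 2 * h₁ - 4 * a₁ * b₂ * hw + 4 * a₁ ^ 2 * h₂
    rw [h5, homEval_pow _ _ _ (natDegree_quadPoly_le _ _ _), h6, mul_pow, ← C_pow, coeff_C_mul,
      coeff_quadPoly_pow_mid h9] at h4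
    have : a₁ ^ l ≠ 0 := pow_ne_zero _ ha
    apply mul_left_cancel₀ this
    rw [mul_left_comm, h4, mul_pow, mul_comm (2 ^ l) (a₁ ^ l)]
    have h44 : (4 : ℂ) ^ l = 2 ^ l * 2 ^ l := by rw [← mul_pow]; norm_num
    rw [h44]
    ring

/-! ### The addition theorem and bounds for harmonics. -/

/-- `u₀ + i u₁`. -/
def cplus (u : E3) : ℂ := (u 0 : ℂ) + Complex.I * (u 1 : ℂ)

lemma conj_cplus (u : E3) : (starRingEnd ℂ) (cplus u) = (u 0 : ℂ) - Complex.I * (u 1 : ℂ) := by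
  simp [cplus, sub_eq_add_neg]

lemma cplus_mul_conj {u : E3} (hu : ‖u‖ = 1) :
    cplus u * (starRingEnd ℂ) (cplus u) = 1 - ((u 2 : ℝ) : ℂ) ^ 2 := by
  have h : ‖u‖ ^ 2 = 1 := by rw [hu, one_pow]
  rw [EuclideanSpace.real_norm_sq_eq, Fin.sum_univ_three] at h
  have h' : (u 0 : ℂ) ^ 2 + (u 1 : ℂ) ^ 2 + (u 2 : ℂ) ^ 2 = 1 := by exact_mod_cast h
  rw [conj_cplus, cplus]
  linear_combination h' - (u 1 : ℂ) ^ 2 * Complex.I_sq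

lemma harmonicNonneg_mul_conj (l m : ℕ) (u v : E3) :
    harmonicNonneg l m u * (starRingEnd ℂ) (harmonicNonneg l m v) =
      ((2 * l + 1) / (4 * Real.pi) * (((l - m)! : ℝ) / ((l + m)! : ℝ)) *
        ((Polynomial.derivative^[m] (legendre l)).eval (u 2)) *
        ((Polynomial.derivative^[m] (legendre l)).eval (v 2)) : ℝ) *
      (cplus u ^ m * (starRingEnd ℂ) (cplus v) ^ m) := by
  have hs : ∀ c : ℝ, 0 ≤ c → ((Real.sqrt c : ℝ) : ℂ) * ((Real.sqrt c : ℝ) : ℂ) = (c : ℂ) := by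
    intro c hc
    rw [← Complex.ofReal_mul, Real.mul_self_sqrt hc]
  have h := hs ((2 * l + 1) / (4 * Real.pi) * (((l - m)! : ℝ) / ((l + m)! : ℝ))) (by positivity)
  have h1 : ((-1 : ℂ) ^ m) * (-1) ^ m = 1 := by rw [← mul_pow]; simp
  rw [harmonicNonneg, harmonicNonneg, ← cplus, ← cplus]
  simp only [map_mul, map_pow, map_neg, map_one, Complex.conj_ofReal]
  rw [Complex.ofReal_mul _ (Polynomial.eval _ _), Complex.ofReal_mul _ (Polynomial.eval _ _), ← h]
  linear_combination (((Real.sqrt ((2 * l + 1) / (4 * Real.pi) *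
      (((l - m)! : ℝ) / ((l + m)! : ℝ))) : ℝ) : ℂ) ^ 2 *
    ((Polynomial.derivative^[m] (legendre l)).eval (u 2) : ℝ) *
    ((Polynomial.derivative^[m] (legendre l)).eval (v 2) : ℝ) *
    (cplus u ^ m * (starRingEnd ℂ) (cplus v) ^ m)) * h1

lemma sphericalHarmonic_natCast (l m : ℕ) (u : E3) :
    sphericalHarmonic l (m : ℤ) u = harmonicNonneg l m u := by
  simp [sphericalHarmonic]

lemma sphericalHarmonic_neg_natCast (l m : ℕ) (hm : 0 < m) (u : E3) :
    sphericalHarmonic l (-(m : ℤ)) u =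
      (-1) ^ m * (starRingEnd ℂ) (harmonicNonneg l m u) := by
  rw [sphericalHarmonic, if_neg (by omega)]
  simp

lemma choose_ratio {l m : ℕ} (hm : m ≤ l) :
    ((2 * l).choose l : ℝ) / ((2 * l).choose (l + m) : ℝ) =
      ((l + m)! * (l - m)! : ℝ) / ((l ! : ℝ) * (l ! : ℝ)) := by
  rw [Nat.cast_choose ℝ (by omega : l ≤ 2 * l), Nat.cast_choose ℝ (by omega : l + m ≤ 2 * l)]
  have h1 : 2 * l - l = l := by omega
  have h2 : 2 * l - (l + m) = l - m := by omega
  rw [h1, h2]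
  have := Nat.factorial_pos (2 * l)
  field_simp

lemma sphericalHarmonic_mul_conj {u v : E3} (hu : ‖u‖ = 1) (hv : ‖v‖ = 1) {l k : ℕ}
    (hk : k < 2 * l + 1) :
    sphericalHarmonic l ((k : ℤ) - l) u * (starRingEnd ℂ) (sphericalHarmonic l ((k : ℤ) - l) v) =
      (2 * l + 1) / (4 * Real.pi) / 4 ^ l * ((2 * l).choose l : ℂ) *
        ((quadPoly (cplus u) (u 2 : ℝ) ((starRingEnd ℂ) (cplus u)) ^ l).coeff k *
          (quadPoly ((starRingEnd ℂ) (cplus v)) (v 2 : ℝ) (cplus v) ^ l).coeff k /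
            ((2 * l).choose k : ℂ)) := by
  have hu' := cplus_mul_conj hu
  have hv' : (starRingEnd ℂ) (cplus v) * cplus v = 1 - ((v 2 : ℝ) : ℂ) ^ 2 := by
    rw [mul_comm, cplus_mul_conj hv]
  -- The binomial weights of the pairing account exactly for the orthonormal factor `(l-m)!/(l+m)!`.
  have key : ∀ m ≤ l, ((2 * l + 1) / (4 * Real.pi) * (((l - m)! : ℝ) / ((l + m)! : ℝ)) *
        ((Polynomial.derivative^[m] (legendre l)).eval (u 2)) *
        ((Polynomial.derivative^[m] (legendre l)).eval (v 2)) : ℝ) =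
      (2 * l + 1) / (4 * Real.pi) / 4 ^ l * ((2 * l).choose l / (2 * l).choose (l + m)) *
       (2 ^ l * (l ! : ℝ) / ((l + m)! : ℝ) *
        (Polynomial.derivative^[m] (legendre l)).eval (u 2)) *
        (2 ^ l * (l ! : ℝ) / ((l + m)! : ℝ) *
        (Polynomial.derivative^[m] (legendre l)).eval (v 2)) := by
    intro m hm
    rw [choose_ratio hm]
    have h4 : (4 : ℝ) ^ l = 2 ^ l * 2 ^ l := by rw [← mul_pow]; norm_num
    rw [h4]
    have := Real.pi_pos
    field_simp
  rcases le_or_gt l k with h | h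
  · obtain ⟨m, rfl⟩ := Nat.exists_eq_add_of_le h
    have e : ((l + m : ℕ) : ℤ) - l = (m : ℤ) := by push_cast; ring
    rw [e, sphericalHarmonic_natCast, sphericalHarmonic_natCast, harmonicNonneg_mul_conj,
      key m (by omega), coeff_quadPoly_pow_high hu', coeff_quadPoly_pow_high hv']
    push_cast
    ring
  · obtain ⟨m, hm⟩ := Nat.exists_eq_add_of_le h.le
    have hk' : k = l - m := by omega
    have e : ((k : ℕ) : ℤ) - l = -(m : ℤ) := by omega
    have hc : (2 * l).choose k = (2 * l).choose (l + m) := by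
      rw [← Nat.choose_symm (by omega)]
      congr 1
      omega
    rw [e, hc, hk', sphericalHarmonic_neg_natCast _ _ (by omega),
      sphericalHarmonic_neg_natCast _ _ (by omega), coeff_quadPoly_pow_low hu' (by omega),
      coeff_quadPoly_pow_low hv' (by omega)]
    -- Negative orders are conjugates, so `u` and `v` exchange roles.
    have h3 := harmonicNonneg_mul_conj l m v u
    rw [mul_right_comm _ _ (Polynomial.eval _ _), key m (by omega)] at h3
    simp only [map_mul, map_pow, map_neg, map_one, Complex.conj_conj]
    rw [mul_mul_mul_comm, mul_comm ((starRingEnd ℂ) (harmonicNonneg l m u)), h3]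
    rw [neg_pow (cplus v), neg_pow ((starRingEnd ℂ) (cplus u))]
    push_cast
    ring

/-- The addition theorem for spherical harmonics. -/
theorem sum_sphericalHarmonic_mul_conj {u v : E3} (hu : ‖u‖ = 1) (hv : ‖v‖ = 1) (l : ℕ) :
    ∑ k ∈ Finset.range (2 * l + 1), sphericalHarmonic l ((k : ℤ) - l) u *
        (starRingEnd ℂ) (sphericalHarmonic l ((k : ℤ) - l) v) =
      (((2 * l + 1) / (4 * Real.pi) * (legendre l).eval (inner ℝ u v) : ℝ) : ℂ) := by
  rw [Finset.sum_congr rfl fun k hk =>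
    sphericalHarmonic_mul_conj hu hv (Finset.mem_range.1 hk), ← Finset.mul_sum, mul_assoc,
    ← formPairing, formPairing_quadPoly (w := inner ℝ u v) (cplus_mul_conj hu) (by simp +contextual)
      (by rw [mul_comm, cplus_mul_conj hv])]
  · push_cast
    field_simp
  -- The polar form of the two quadratics is twice the Euclidean inner product.
  · rw [PiLp.inner_apply, Fin.sum_univ_three, conj_cplus, conj_cplus, cplus, cplus]
    simp only [RCLike.inner_apply, conj_trivial]
    push_cast
    linear_combination -2 * (u 1 : ℂ) * (v 1 : ℂ) * Complex.I_sq

lemma legendre_eval_one (l : ℕ) : (legendre l).eval 1 = 1 := by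
  have h := coeff_quadPoly_pow_mid (a := 0) (b := 0) (z := 1) (by simp) l
  have h1 : quadPoly 0 (1 : ℝ) 0 = Polynomial.C 2 * Polynomial.X := by simp [quadPoly]
  rw [h1, mul_pow, ← Polynomial.C_pow, Polynomial.coeff_C_mul, Polynomial.coeff_X_pow,
    if_pos rfl, mul_one] at h
  have h2 : (2 : ℂ) ^ l ≠ 0 := pow_ne_zero _ two_ne_zero
  have h3 : (((legendre l).eval 1 : ℝ) : ℂ) = 1 := by
    apply mul_left_cancel₀ h2
    rw [← h, mul_one]
  exact_mod_cast h3

lemma sum_norm_sq_sphericalHarmonic {u : E3} (hu : ‖u‖ = 1) (l : ℕ) :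
    ∑ k ∈ Finset.range (2 * l + 1), ‖sphericalHarmonic l ((k : ℤ) - l) u‖ ^ 2 =
      (2 * l + 1) / (4 * Real.pi) := by
  have h := sum_sphericalHarmonic_mul_conj hu hu l
  simp only [Complex.mul_conj, Complex.normSq_eq_norm_sq] at h
  rw [real_inner_self_eq_norm_sq, hu, one_pow, legendre_eval_one, mul_one] at h
  exact_mod_cast h

lemma norm_sphericalHarmonic_le {u : E3} (hu : ‖u‖ = 1) {l k : ℕ} (hk : k < 2 * l + 1) :
    ‖sphericalHarmonic l ((k : ℤ) - l) u‖ ≤ Real.sqrt ((2 * l + 1) / (4 * Real.pi)) := by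
  apply Real.le_sqrt_of_sq_le
  rw [← sum_norm_sq_sphericalHarmonic hu]
  exact Finset.single_le_sum (f := fun k : ℕ => ‖sphericalHarmonic l ((k : ℤ) - l) u‖ ^ 2)
    (fun _ _ => sq_nonneg _) (Finset.mem_range.2 hk)

/-- The addition theorem with `2|ab| ≤ |a|² + |b|²`, each sum of squares being `(2l+1)/(4π)`. -/
lemma abs_legendre_inner_le {u v : E3} (hu : ‖u‖ = 1) (hv : ‖v‖ = 1) (l : ℕ) :
    |(legendre l).eval (inner ℝ u v)| ≤ 1 := by
  have h := sum_sphericalHarmonic_mul_conj hu hv l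
  set s := Finset.range (2 * l + 1)
  have h0 : (0 : ℝ) < (2 * l + 1) / (4 * Real.pi) := by positivity
  have h1 : (2 * l + 1) / (4 * Real.pi) * |(legendre l).eval (inner ℝ u v)| ≤
      ∑ k ∈ s, (‖sphericalHarmonic l ((k : ℤ) - l) u‖ ^ 2 +
        ‖sphericalHarmonic l ((k : ℤ) - l) v‖ ^ 2) / 2 := by
    rw [← abs_of_pos h0, ← abs_mul, ← Real.norm_eq_abs, ← Complex.norm_real, ← h]
    refine (norm_sum_le _ _).trans (Finset.sum_le_sum fun k _ => ?_)
    rw [norm_mul, RCLike.norm_conj]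
    nlinarith [sq_nonneg (‖sphericalHarmonic l ((k : ℤ) - l) u‖ -
      ‖sphericalHarmonic l ((k : ℤ) - l) v‖)]
  rw [← Finset.sum_div, Finset.sum_add_distrib, sum_norm_sq_sphericalHarmonic hu,
    sum_norm_sq_sphericalHarmonic hv, add_self_div_two] at h1
  exact le_of_mul_le_mul_left (by rwa [mul_one]) h0

lemma abs_legendre_le {t : ℝ} (ht : t ∈ Set.Icc (-1 : ℝ) 1) (l : ℕ) :
    |(legendre l).eval t| ≤ 1 := by
  have h0 : 0 ≤ 1 - t ^ 2 := by nlinarith [ht.1, ht.2]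
  have hu : ‖(!₂[Real.sqrt (1 - t ^ 2), 0, t] : E3)‖ = 1 := by
    rw [EuclideanSpace.norm_eq, Fin.sum_univ_three]
    simp [Real.sq_sqrt h0]
  have hv : ‖(!₂[0, 0, 1] : E3)‖ = 1 := by
    rw [EuclideanSpace.norm_eq, Fin.sum_univ_three]
    simp
  have := abs_legendre_inner_le hu hv l
  rw [PiLp.inner_apply, Fin.sum_univ_three] at this
  simpa using this

/-! ### Recurrences and bounds for `k_ℓ`. -/

/-- The reduced function `k_ℓ(w) / w^ℓ`. -/
def redK (l : ℕ) (w : ℝ) : ℝ := besselK l w / w ^ l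

/-- These coefficients vanish for `s > l`, so sums for different `l` can share one range and be
compared termwise. -/
lemma besselK_eq (l : ℕ) (w : ℝ) {n : ℕ} (hn : l < n) :
    besselK l w = Real.exp (-w) / w * ∑ s ∈ Finset.range n,
      (((l + s).choose (2 * s) * (2 * s).descFactorial s : ℕ) : ℝ) * ((2 * w) ^ s)⁻¹ := by
  rw [besselK]
  congr 1
  have hsub : Finset.range (l + 1) ⊆ Finset.range n := Finset.range_mono hn
  rw [← Finset.sum_subset hsub]
  · refine Finset.sum_congr rfl fun s hs => ?_
    have hs' : s ≤ l := by simpa [Nat.lt_succ_iff] using hs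
    congr 1
    have h1 := Nat.choose_mul_factorial_mul_factorial (by omega : 2 * s ≤ l + s)
    have h2 := Nat.factorial_mul_descFactorial (by omega : s ≤ 2 * s)
    have e1 : l + s - 2 * s = l - s := by omega
    have e2 : 2 * s - s = s := by omega
    rw [e1, ← h2, e2] at h1
    rw [div_eq_iff (by positivity), ← h1]
    push_cast
    ring
  · intro s _ hs
    rw [Nat.choose_eq_zero_of_lt (by simp at hs; omega)]
    simp

/-- The coefficientwise form of `k_{l+2} = k_l + (2l+3)/w · k_{l+1}`, from Pascal's rule. -/
lemma choose_descFactorial_rec (l s : ℕ) :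
    (l + 2 + (s + 1)).choose (2 * (s + 1)) * (2 * (s + 1)).descFactorial (s + 1) =
      (l + (s + 1)).choose (2 * (s + 1)) * (2 * (s + 1)).descFactorial (s + 1) +
        2 * (2 * l + 3) * ((l + 1 + s).choose (2 * s) * (2 * s).descFactorial s) := by
  have hd : (2 * (s + 1)).descFactorial (s + 1) = 2 * (2 * s + 1) * (2 * s).descFactorial s := by
    have h1 := Nat.factorial_mul_descFactorial (by omega : s ≤ 2 * s)
    have h2 := Nat.factorial_mul_descFactorial (by omega : s + 1 ≤ 2 * (s + 1))
    have e1 : 2 * s - s = s := by omega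
    have e2 : 2 * (s + 1) - (s + 1) = s + 1 := by omega
    rw [e1] at h1
    rw [e2, mul_add, mul_one, Nat.factorial_succ, Nat.factorial_succ, Nat.factorial_succ, ← h1] at h2
    have : 0 < (s + 1) * s ! := by positivity
    apply Nat.eq_of_mul_eq_mul_left this
    rw [mul_add 2 s 1, mul_one, h2]
    ring
  rw [hd]
  have hc : (2 * s + 1) * (l + 2 + (s + 1)).choose (2 * (s + 1)) =
      (2 * s + 1) * (l + (s + 1)).choose (2 * (s + 1)) +
        (2 * l + 3) * (l + 1 + s).choose (2 * s) := by
    have e1 : l + 2 + (s + 1) = (l + 1 + s + 1) + 1 := by ring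
    have e2 : l + (s + 1) = l + 1 + s := by ring
    have e3 : 2 * (s + 1) = (2 * s + 1) + 1 := by ring
    rw [e1, e2, e3, Nat.choose_succ_succ, Nat.choose_succ_succ (l + 1 + s) (2 * s + 1),
      Nat.choose_succ_succ (l + 1 + s) (2 * s)]
    have h := Nat.choose_succ_right_eq (l + 1 + s) (2 * s)
    rcases le_or_gt (2 * s) (l + 1 + s) with hle | hlt
    · obtain ⟨d, hd⟩ := Nat.exists_eq_add_of_le hle
      have e4 : l + 1 + s - 2 * s = d := by omega
      rw [e4] at h
      have e5 : 2 * l + 3 = 2 * d + 2 * s + 1 := by omega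
      rw [e5]
      linarith
    · simp only [Nat.succ_eq_add_one, Nat.choose_eq_zero_of_lt hlt,
        Nat.choose_eq_zero_of_lt (by omega : l + 1 + s < 2 * s + 1)]
      ring
  linear_combination 2 * (2 * s).descFactorial s * hc

lemma redK_rec (l : ℕ) {w : ℝ} (hw : w ≠ 0) :
    w ^ 2 * redK (l + 2) w = redK l w + (2 * l + 3) * redK (l + 1) w := by
  have key : besselK (l + 2) w = besselK l w + (2 * l + 3) / w * besselK (l + 1) w := by
    rw [besselK_eq (l + 2) w (n := l + 3 + 1) (by omega),
      besselK_eq l w (n := l + 3 + 1) (by omega),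
      besselK_eq (l + 1) w (n := l + 3) (by omega), Finset.sum_range_succ' _ (l + 3),
      Finset.sum_range_succ' _ (l + 3)]
    have h : ∑ k ∈ Finset.range (l + 3),
        (((l + 2 + (k + 1)).choose (2 * (k + 1)) * (2 * (k + 1)).descFactorial (k + 1) : ℕ) : ℝ) *
          ((2 * w) ^ (k + 1))⁻¹ =
        ∑ k ∈ Finset.range (l + 3),
        (((l + (k + 1)).choose (2 * (k + 1)) * (2 * (k + 1)).descFactorial (k + 1) : ℕ) : ℝ) *
          ((2 * w) ^ (k + 1))⁻¹ + (2 * l + 3) / w * ∑ k ∈ Finset.range (l + 3),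
        (((l + 1 + k).choose (2 * k) * (2 * k).descFactorial k : ℕ) : ℝ) * ((2 * w) ^ k)⁻¹ := by
      rw [Finset.mul_sum, ← Finset.sum_add_distrib]
      refine Finset.sum_congr rfl fun k _ => ?_
      rw [choose_descFactorial_rec, pow_succ]
      push_cast
      field_simp
    rw [h]
    simp
    ring
  rw [redK, redK, redK, key]
  field_simp
  ring

lemma redK_zero (w : ℝ) : redK 0 w = Real.exp (-w) / w := by
  simp [redK, besselK]

lemma redK_one {w : ℝ} (hw : w ≠ 0) : redK 1 w = Real.exp (-w) * (1 + w) / w ^ 3 := by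
  simp [redK, besselK, Finset.sum_range_succ]
  field_simp
  ring

/-- Explicit for `l = 0, 1`; the three-term recurrence carries it upward. This is why dividing by
`w^l` is convenient: `w⁻¹ d/dw` simply raises the index. -/
lemma hasDerivAt_redK (l : ℕ) {w : ℝ} (hw : 0 < w) :
    HasDerivAt (redK l) (-w * redK (l + 1) w) w := by
  have he : HasDerivAt (fun w : ℝ => Real.exp (-w)) (-Real.exp (-w)) w := by
    simpa using (hasDerivAt_neg w).exp
  induction l using Nat.twoStepInduction with
  | zero =>
    have h : redK 0 = fun w => Real.exp (-w) / w := funext redK_zero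
    rw [h]
    refine (he.div (hasDerivAt_id w) hw.ne').congr_deriv ?_
    rw [zero_add, redK_one hw.ne']
    simp only [id]
    field_simp
    ring
  | one =>
    have h : redK 1 =ᶠ[nhds w] fun w => Real.exp (-w) * (1 + w) / w ^ 3 := by
      filter_upwards [eventually_gt_nhds hw] with v hv using redK_one hv.ne'
    refine HasDerivAt.congr_of_eventuallyEq ?_ h
    refine ((he.mul ((hasDerivAt_id w).const_add 1)).div (hasDerivAt_pow 3 w)
      (by positivity)).congr_deriv ?_
    have h2 := redK_rec 0 hw.ne'
    have h3 : redK 2 w = (redK 0 w + 3 * redK 1 w) / w ^ 2 := by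
      rw [eq_div_iff (by positivity), mul_comm]; simpa using h2
    rw [h3, redK_zero, redK_one hw.ne']
    simp only [id]
    field_simp
    simp
    ring
  | more l ih0 ih1 =>
    have h : redK (l + 2) =ᶠ[nhds w]
        fun w => (redK l w + (2 * l + 3) * redK (l + 1) w) / w ^ 2 := by
      filter_upwards [eventually_gt_nhds hw] with v hv
      rw [← redK_rec l hv.ne']
      field_simp
    refine HasDerivAt.congr_of_eventuallyEq ?_ h
    refine ((ih0.add (ih1.const_mul (2 * (l : ℝ) + 3))).div (hasDerivAt_pow 2 w)
      (by positivity)).congr_deriv ?_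
    have h2 := redK_rec (l + 1) hw.ne'
    have h1 := redK_rec l hw.ne'
    have h3 : (redK l + fun y => (2 * (l : ℝ) + 3) * redK (l + 1) y) w =
        w ^ 2 * redK (l + 2) w := h1.symm
    rw [div_eq_iff (by positivity), h3]
    push_cast at h2 ⊢
    linear_combination w ^ 3 * h2

lemma besselK_nonneg (l : ℕ) {x : ℝ} (hx : 0 < x) : 0 ≤ besselK l x := by
  unfold besselK
  positivity

lemma factorial_ratio_le {l s : ℕ} (hs : s ≤ l) :
    ((l + s)! : ℝ) / (s ! : ℝ) * 2 ^ (l - s) ≤ ((2 * l)! : ℝ) / (l ! : ℝ) := by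
  induction l, hs using Nat.le_induction with
  | base => simp [two_mul]
  | succ l hs ih =>
    have e : l + 1 - s = (l - s) + 1 := by omega
    have e1 : l + 1 + s = (l + s) + 1 := by ring
    have e2 : 2 * (l + 1) = (2 * l + 1) + 1 := by ring
    have h1 : ((2 * (l + 1))! : ℝ) / ((l + 1)! : ℝ) =
        2 * (2 * l + 1) * (((2 * l)! : ℝ) / (l ! : ℝ)) := by
      rw [e2, Nat.factorial_succ, Nat.factorial_succ, Nat.factorial_succ]
      push_cast
      field_simp
      ring
    have h2 : ((l + 1 + s)! : ℝ) / (s ! : ℝ) * 2 ^ (l + 1 - s) =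
        2 * (l + s + 1) * (((l + s)! : ℝ) / (s ! : ℝ) * 2 ^ (l - s)) := by
      rw [e, e1, Nat.factorial_succ, pow_succ]
      push_cast
      ring
    rw [h1, h2]
    have hs' : (s : ℝ) ≤ l := by exact_mod_cast hs
    exact mul_le_mul (by linarith) ih (by positivity) (by positivity)

/-- Factoring out the most singular term, `s = l`, leaves at most a truncated exponential series in
`x`, which `e^(-x)` cancels. -/
lemma besselK_le (l : ℕ) {x : ℝ} (hx : 0 < x) :
    besselK l x ≤ ((2 * l)! : ℝ) / (2 ^ l * (l ! : ℝ)) / x ^ (l + 1) := by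
  have h1 : ∀ s ∈ Finset.range (l + 1), ((l + s)! : ℝ) / ((s ! : ℝ) * ((l - s)! : ℝ)) *
      ((2 * x) ^ s)⁻¹ ≤ ((2 * l)! : ℝ) / (2 ^ l * (l ! : ℝ)) / x ^ l *
        (x ^ (l - s) / ((l - s)! : ℝ)) := by
    intro s hs
    have hs' : s ≤ l := by simpa [Nat.lt_succ_iff] using hs
    have h := factorial_ratio_le hs'
    obtain ⟨d, rfl⟩ := Nat.exists_eq_add_of_le hs'
    have e : s + d - s = d := by omega
    rw [e]
    have h2 : (0 : ℝ) ≤ (2 ^ (s + d) * (d ! : ℝ) * x ^ s)⁻¹ := by positivity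
    have h3 := mul_le_mul_of_nonneg_right h h2
    refine le_of_eq_of_le ?_ (h3.trans (le_of_eq ?_))
    · rw [e]; rw [mul_pow, pow_add]; field_simp
    · rw [pow_add x]; field_simp
  have h2 : ∑ s ∈ Finset.range (l + 1), x ^ (l - s) / ((l - s)! : ℝ) ≤ Real.exp x := by
    rw [← Finset.sum_range_reflect]
    refine le_trans (le_of_eq ?_) (Real.sum_le_exp_of_nonneg hx.le (l + 1))
    refine Finset.sum_congr rfl fun s hs => ?_
    have hs' : s ≤ l := by simpa [Nat.lt_succ_iff] using hs
    have e : l - (l + 1 - 1 - s) = s := by omega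
    rw [e]
  rw [besselK]
  calc _ ≤ Real.exp (-x) / x * (((2 * l)! : ℝ) / (2 ^ l * (l ! : ℝ)) / x ^ l * Real.exp x) := by
        apply mul_le_mul_of_nonneg_left _ (by positivity)
        refine (Finset.sum_le_sum h1).trans ?_
        rw [← Finset.mul_sum]
        exact mul_le_mul_of_nonneg_left h2 (by positivity)
    _ = _ := by
        rw [Real.exp_neg, pow_succ]
        have := Real.exp_pos x
        field_simp

/-! ### Recurrences and bounds for `i_ℓ`. -/

/-- The terms of the power series of `i_ℓ(y) / y^ℓ`. -/
def redITerm (l : ℕ) (y : ℝ) (s : ℕ) : ℝ :=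
  y ^ (2 * s) / (2 ^ s * (s ! : ℝ) * ((2 * l + 2 * s + 1)‼ : ℝ))

/-- The reduced function `i_ℓ(y) / y^ℓ`. -/
def redI (l : ℕ) (y : ℝ) : ℝ := ∑' s : ℕ, redITerm l y s

lemma doubleFactorial_eq_ascPochhammer (l s : ℕ) :
    ((2 * l + 2 * s + 1)‼ : ℝ) =
      ((2 * l + 1)‼ : ℝ) * 2 ^ s * (ascPochhammer ℝ s).eval ((l : ℝ) + 3 / 2) := by
  induction s with
  | zero => simp
  | succ s ih =>
    have e : 2 * l + 2 * (s + 1) + 1 = (2 * l + 2 * s + 1) + 2 := by ring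
    rw [e, Nat.doubleFactorial_add_two, ascPochhammer_succ_eval]
    push_cast
    rw [ih]
    ring

lemma besselI_eq (l : ℕ) (y : ℝ) : besselI l y = y ^ l * redI l y := by
  rw [besselI, redI, div_mul_eq_mul_div, mul_div_assoc, ← tsum_div_const]
  congr 2
  ext s
  have h : 0 < (ascPochhammer ℝ s).eval ((l : ℝ) + 3 / 2) := ascPochhammer_pos s _ (by positivity)
  rw [redITerm, doubleFactorial_eq_ascPochhammer, div_pow, pow_mul 2 2 s]
  have h4 : ((2 : ℝ) ^ 2) ^ s = 2 ^ s * 2 ^ s := by rw [← mul_pow]; norm_num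
  rw [h4]
  have := Nat.doubleFactorial_pos (2 * l + 1)
  field_simp

lemma doubleFactorial_le_add_two_mul (n s : ℕ) : n‼ ≤ (n + 2 * s)‼ := by
  induction s with
  | zero => simp
  | succ s ih =>
    have e : n + 2 * (s + 1) = (n + 2 * s) + 2 := by ring
    rw [e, Nat.doubleFactorial_add_two]
    exact ih.trans (Nat.le_mul_of_pos_left _ (by omega))

lemma redITerm_nonneg (l : ℕ) (y : ℝ) (s : ℕ) : 0 ≤ redITerm l y s := by
  rw [redITerm, pow_mul]
  positivity

lemma redITerm_le (l : ℕ) (y : ℝ) (s : ℕ) :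
    redITerm l y s ≤ (y ^ 2 / 2) ^ s / (s ! : ℝ) / ((2 * l + 1)‼ : ℝ) := by
  have h1 : ((2 * l + 1)‼ : ℝ) ≤ ((2 * l + 2 * s + 1)‼ : ℝ) := by
    have := doubleFactorial_le_add_two_mul (2 * l + 1) s
    rw [show 2 * l + 1 + 2 * s = 2 * l + 2 * s + 1 by ring] at this
    exact_mod_cast this
  have h2 : (0 : ℝ) < ((2 * l + 1)‼ : ℝ) := by exact_mod_cast Nat.doubleFactorial_pos _
  rw [redITerm, div_pow, ← pow_mul, div_div, div_div, ← mul_assoc ((2 : ℝ) ^ s)]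
  apply div_le_div_of_nonneg_left _ (mul_pos (by positivity) h2)
  · exact mul_le_mul_of_nonneg_left h1 (by positivity)
  · rw [pow_mul]
    positivity

lemma summable_redITerm (l : ℕ) (y : ℝ) : Summable (redITerm l y) :=
  Summable.of_nonneg_of_le (redITerm_nonneg l y) (redITerm_le l y)
    ((Real.summable_pow_div_factorial _).div_const _)

lemma hasSum_redI (l : ℕ) (y : ℝ) : HasSum (redITerm l y) (redI l y) :=
  (summable_redITerm l y).hasSum

lemma redI_nonneg (l : ℕ) (y : ℝ) : 0 ≤ redI l y := tsum_nonneg (redITerm_nonneg l y)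

lemma redI_le (l : ℕ) (y : ℝ) : redI l y ≤ Real.exp (y ^ 2 / 2) / ((2 * l + 1)‼ : ℝ) := by
  have h : HasSum (fun s : ℕ => (y ^ 2 / 2) ^ s / (s ! : ℝ)) (Real.exp (y ^ 2 / 2)) := by
    rw [Real.exp_eq_exp_ℝ]
    exact NormedSpace.expSeries_div_hasSum_exp _
  exact hasSum_le (redITerm_le l y) (hasSum_redI l y) (h.div_const _)

/-- Coefficientwise: the constant terms of the first two series cancel, and the rest is the third
series shifted by one. -/
lemma redI_rec (l : ℕ) (y : ℝ) :
    redI l y = (2 * l + 3) * redI (l + 1) y + y ^ 2 * redI (l + 2) y := by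
  have h1 := (hasSum_redI l y).sub ((hasSum_redI (l + 1) y).mul_left (2 * (l : ℝ) + 3))
  have h2 := (hasSum_redI (l + 2) y).mul_left (y ^ 2)
  have h3 := (hasSum_nat_add_iff' (f := fun s => redITerm l y s - (2 * l + 3) *
    redITerm (l + 1) y s) 1).2 h1
  have h0 : redITerm l y 0 - (2 * l + 3) * redITerm (l + 1) y 0 = 0 := by
    rw [redITerm, redITerm]
    have e : 2 * (l + 1) + 2 * 0 + 1 = (2 * l + 1) + 2 := by ring
    rw [e, Nat.doubleFactorial_add_two]
    have := Nat.doubleFactorial_pos (2 * l + 1)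
    push_cast
    field_simp
    simp
    ring
  have h4 : ∀ s, redITerm l y (s + 1) - (2 * l + 3) * redITerm (l + 1) y (s + 1) =
      y ^ 2 * redITerm (l + 2) y s := by
    intro s
    rw [redITerm, redITerm, redITerm]
    have e1 : 2 * (l + 1) + 2 * (s + 1) + 1 = (2 * l + 2 * (s + 1) + 1) + 2 := by ring
    have e2 : 2 * (l + 2) + 2 * s + 1 = (2 * l + 2 * (s + 1) + 1) + 2 := by ring
    rw [e1, e2, Nat.doubleFactorial_add_two, Nat.factorial_succ]
    have := Nat.doubleFactorial_pos (2 * l + 2 * (s + 1) + 1)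
    push_cast
    field_simp
    ring
  simp only [Finset.sum_range_one, h0, sub_zero] at h3
  simp only [h4] at h3
  have := h3.unique h2
  linarith

lemma factorial_eq_two_pow (n : ℕ) :
    ((2 * n + 1)! : ℝ) = 2 ^ n * (n ! : ℝ) * ((2 * n + 1)‼ : ℝ) := by
  rw [Nat.factorial_eq_mul_doubleFactorial, Nat.doubleFactorial_two_mul]
  push_cast
  ring

lemma redI_zero {y : ℝ} (hy : y ≠ 0) : redI 0 y = Real.sinh y / y := by
  refine (hasSum_redI 0 y).unique ?_
  have h := (Real.hasSum_sinh y).div_const y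
  refine h.congr_fun fun s => ?_
  have h1 := factorial_eq_two_pow s
  have e : 2 * 0 + 2 * s + 1 = 2 * s + 1 := by ring
  rw [redITerm, e, ← h1, pow_succ]
  field_simp

lemma redI_one {y : ℝ} (hy : y ≠ 0) :
    redI 1 y = (y * Real.cosh y - Real.sinh y) / y ^ 3 := by
  refine (hasSum_redI 1 y).unique ?_
  have h := ((Real.hasSum_cosh y).mul_left y).sub (Real.hasSum_sinh y)
  have h1 := ((hasSum_nat_add_iff' 1).2 h).div_const (y ^ 3)
  simp only [Finset.sum_range_one, mul_zero, pow_zero, zero_add, pow_one, Nat.factorial_zero,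
    Nat.factorial_one, Nat.cast_one, div_one, mul_one, sub_self, sub_zero] at h1
  refine h1.congr_fun fun s => ?_
  have h2 := factorial_eq_two_pow (s + 1)
  have e1 : 2 * 1 + 2 * s + 1 = 2 * (s + 1) + 1 := by ring
  have e2 : 2 * (s + 1) = 2 * s + 1 + 1 := by ring
  have h3 : ((2 * (s + 1))! : ℝ) = ((2 * (s + 1) + 1)! : ℝ) / (2 * s + 3) := by
    rw [Nat.factorial_succ (2 * (s + 1)), eq_div_iff (by positivity)]
    push_cast
    ring
  have := Nat.doubleFactorial_pos (2 * (s + 1) + 1)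
  rw [redITerm, e1, h3, h2, Nat.factorial_succ]
  push_cast
  field_simp
  ring

/-- As for `redK`: the closed forms in `sinh` and `cosh` settle `l = 0, 1`, and the recurrence does
the rest. -/
lemma hasDerivAt_redI (l : ℕ) {y : ℝ} (hy : 0 < y) :
    HasDerivAt (redI l) (y * redI (l + 1) y) y := by
  induction l using Nat.twoStepInduction with
  | zero =>
    have h : redI 0 =ᶠ[nhds y] fun w => Real.sinh w / w := by
      filter_upwards [eventually_gt_nhds hy] with v hv using redI_zero hv.ne'
    refine HasDerivAt.congr_of_eventuallyEq ?_ h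
    refine ((Real.hasDerivAt_sinh y).div (hasDerivAt_id y) hy.ne').congr_deriv ?_
    rw [zero_add, redI_one hy.ne']
    simp only [id]
    field_simp
  | one =>
    have h : redI 1 =ᶠ[nhds y] fun w => (w * Real.cosh w - Real.sinh w) / w ^ 3 := by
      filter_upwards [eventually_gt_nhds hy] with v hv using redI_one hv.ne'
    refine HasDerivAt.congr_of_eventuallyEq ?_ h
    refine ((((hasDerivAt_id y).mul (Real.hasDerivAt_cosh y)).sub (Real.hasDerivAt_sinh y)).div
      (hasDerivAt_pow 3 y) (by positivity)).congr_deriv ?_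
    have h2 := redI_rec 0 y
    have h3 : redI 2 y = (redI 0 y - 3 * redI 1 y) / y ^ 2 := by
      rw [eq_div_iff (by positivity)]; simp at h2; linarith
    rw [h3, redI_zero hy.ne', redI_one hy.ne']
    simp
    field_simp
  | more l ih0 ih1 =>
    have h : redI (l + 2) =ᶠ[nhds y]
        fun w => (redI l w - (2 * l + 3) * redI (l + 1) w) / w ^ 2 := by
      filter_upwards [eventually_gt_nhds hy] with v hv
      rw [redI_rec l v]
      field_simp
      ring
    refine HasDerivAt.congr_of_eventuallyEq ?_ h
    refine ((ih0.sub (ih1.const_mul (2 * (l : ℝ) + 3))).div (hasDerivAt_pow 2 y)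
      (by positivity)).congr_deriv ?_
    have h2 := redI_rec (l + 1) y
    have h1 := redI_rec l y
    have h3 : (redI l - fun w => (2 * (l : ℝ) + 3) * redI (l + 1) w) y =
        y ^ 2 * redI (l + 2) y := by
      simp only [Pi.sub_apply]; linarith
    rw [div_eq_iff (by positivity), h3]
    push_cast at h2 ⊢
    linear_combination y ^ 3 * h2

lemma besselI_nonneg (l : ℕ) {y : ℝ} (hy : 0 ≤ y) : 0 ≤ besselI l y := by
  rw [besselI_eq]
  exact mul_nonneg (pow_nonneg hy l) (redI_nonneg l y)

lemma besselI_le (l : ℕ) {y Y : ℝ} (hy : 0 ≤ y) (hyY : y ≤ Y) :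
    besselI l y ≤ Real.exp (Y ^ 2 / 2) * Y ^ l / ((2 * l + 1)‼ : ℝ) := by
  rw [besselI_eq, mul_comm, mul_div_right_comm]
  refine mul_le_mul ((redI_le l y).trans ?_) (pow_le_pow_left₀ hy hyY l) (pow_nonneg hy l)
    (by positivity)
  gcongr

/-- The factorials of the two bounds cancel against `2l+1`, leaving a purely geometric dependence on
`l`. -/
lemma besselI_mul_besselK_le (l : ℕ) {y Y x : ℝ} (hy : 0 ≤ y) (hyY : y ≤ Y) (hx : 0 < x) :
    (2 * l + 1) * besselI l y * besselK l x ≤ Real.exp (Y ^ 2 / 2) / x * (Y / x) ^ l := by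
  have h := mul_le_mul (besselI_le l hy hyY) (besselK_le l hx) (besselK_nonneg l hx)
    (by have := hy.trans hyY; positivity)
  rw [mul_assoc]
  refine (mul_le_mul_of_nonneg_left h (by positivity)).trans (le_of_eq ?_)
  have h1 := factorial_eq_two_pow l
  rw [Nat.factorial_succ] at h1
  have h2 : ((2 * l)! : ℝ) = 2 ^ l * (l ! : ℝ) * ((2 * l + 1)‼ : ℝ) / (2 * l + 1) := by
    rw [eq_div_iff (by positivity), ← h1]
    push_cast
    ring
  have := Nat.doubleFactorial_pos (2 * l + 1)
  rw [h2, div_pow]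
  field_simp
  ring

/-! ### The mean value integral of the kernel. -/

/-- Differentiation under the integral sign over a compact interval, for a jointly continuous
derivative. -/
lemma hasDerivAt_intervalIntegral_param {f f' : ℝ → ℝ → ℝ} {U : Set ℝ} (hU : IsOpen U)
    {a b : ℝ} (hab : a ≤ b) (hf : ∀ x ∈ U, ContinuousOn (f x) (Set.Icc a b))
    (hd : ∀ x ∈ U, ∀ t ∈ Set.Icc a b, HasDerivAt (fun x => f x t) (f' x t) x)
    (hf' : ContinuousOn (fun p : ℝ × ℝ => f' p.1 p.2) (U ×ˢ Set.Icc a b)) {x₀ : ℝ}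
    (hx : x₀ ∈ U) :
    HasDerivAt (fun x => ∫ t in a..b, f x t) (∫ t in a..b, f' x₀ t) x₀ := by
  obtain ⟨ε, hε, hball⟩ := Metric.nhds_basis_closedBall.mem_iff.1 (hU.mem_nhds hx)
  obtain ⟨C, hC⟩ := ((isCompact_closedBall x₀ ε).prod isCompact_Icc).exists_bound_of_continuousOn
    (hf'.mono (Set.prod_mono hball subset_rfl))
  have hsub : Set.uIoc a b ⊆ Set.Icc a b := by
    rw [Set.uIoc_of_le hab]; exact Set.Ioc_subset_Icc_self
  refine (intervalIntegral.hasDerivAt_integral_of_dominated_loc_of_deriv_le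
    (bound := fun _ => C) (closedBall_mem_nhds x₀ hε) ?_ ?_ ?_ ?_ ?_ ?_).2
  · filter_upwards [hU.mem_nhds hx] with x hx'
    exact ((hf x hx').mono hsub).aestronglyMeasurable measurableSet_uIoc
  · exact (hf x₀ hx).intervalIntegrable_of_Icc hab
  · have : ContinuousOn (f' x₀) (Set.Icc a b) :=
      hf'.comp (f := fun t => (x₀, t)) (by fun_prop) (fun t ht => ⟨hx, ht⟩)
    exact (this.mono hsub).aestronglyMeasurable measurableSet_uIoc
  · exact Filter.Eventually.of_forall fun t ht x hx' => hC (x, t) ⟨hx', hsub ht⟩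
  · exact intervalIntegrable_const
  · exact Filter.Eventually.of_forall fun t ht x hx' => hd x (hball hx') t (hsub ht)

/-- `k_ℓ(w) / w^ℓ` as a function of `w²`. -/
def sqK (l : ℕ) (s : ℝ) : ℝ := redK l (Real.sqrt s)

lemma hasDerivAt_sqK (l : ℕ) {s : ℝ} (hs : 0 < s) :
    HasDerivAt (sqK l) (-(1 / 2) * sqK (l + 1) s) s := by
  have h := (hasDerivAt_redK l (Real.sqrt_pos.2 hs)).comp s (Real.hasDerivAt_sqrt hs.ne')
  refine h.congr_deriv ?_
  have := Real.sqrt_pos.2 hs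
  rw [sqK]
  field_simp

lemma continuousOn_sqK (l : ℕ) : ContinuousOn (sqK l) (Set.Ioi 0) := fun _ hs =>
  (hasDerivAt_sqK l hs).continuousAt.continuousWithinAt

lemma sqK_rec (l : ℕ) {s : ℝ} (hs : 0 < s) :
    s * sqK (l + 2) s = sqK l s + (2 * l + 3) * sqK (l + 1) s := by
  have h := redK_rec l (Real.sqrt_pos.2 hs).ne'
  rwa [Real.sq_sqrt hs.le] at h

/-- The law of cosines. -/
def cosLaw (x y t : ℝ) : ℝ := x ^ 2 + y ^ 2 - 2 * x * y * t

lemma cosLaw_pos {x y t : ℝ} (hy : 0 < y) (hyx : y < x) (ht : t ∈ Set.Icc (-1 : ℝ) 1) :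
    0 < cosLaw x y t := by
  have h1 : 0 < (x - y) ^ 2 := pow_pos (by linarith) 2
  have h2 : 0 ≤ x * y * (1 - t) :=
    mul_nonneg (mul_nonneg (by linarith) hy.le) (by linarith [ht.2])
  rw [cosLaw]
  nlinarith

lemma continuousOn_sqK_cosLaw {α : Type*} [TopologicalSpace α] (l : ℕ) {S : Set α}
    {x y t : α → ℝ} (hx : ContinuousOn x S) (hy : ContinuousOn y S) (ht : ContinuousOn t S)
    (h : ∀ a ∈ S, 0 < y a ∧ y a < x a ∧ t a ∈ Set.Icc (-1 : ℝ) 1) :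
    ContinuousOn (fun a => sqK l (cosLaw (x a) (y a) (t a))) S := by
  refine (continuousOn_sqK l).comp (f := fun a => cosLaw (x a) (y a) (t a)) ?_
    fun a ha => cosLaw_pos (h a ha).1 (h a ha).2.1 (h a ha).2.2
  unfold cosLaw
  fun_prop

/-- `cosLaw` is affine in `t`, so iterated `t`-derivatives only raise the index and multiply by `x
y`. -/
lemma hasDerivAt_sqK_cosLaw_t (l : ℕ) {x y t : ℝ} (hy : 0 < y) (hyx : y < x)
    (ht : t ∈ Set.Icc (-1 : ℝ) 1) :
    HasDerivAt (fun t => sqK l (cosLaw x y t)) (x * y * sqK (l + 1) (cosLaw x y t)) t := by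
  have h1 : HasDerivAt (fun t => cosLaw x y t) (-(2 * x * y)) t := by
    unfold cosLaw
    simpa using ((hasDerivAt_id t).const_mul (2 * x * y)).const_sub (x ^ 2 + y ^ 2)
  refine ((hasDerivAt_sqK l (cosLaw_pos hy hyx ht)).comp t h1).congr_deriv ?_
  ring

lemma hasDerivAt_sqK_cosLaw_y (l : ℕ) {x y t : ℝ} (hy : 0 < y) (hyx : y < x)
    (ht : t ∈ Set.Icc (-1 : ℝ) 1) :
    HasDerivAt (fun y => sqK l (cosLaw x y t)) (sqK (l + 1) (cosLaw x y t) * (x * t - y)) y := by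
  have h1 : HasDerivAt (fun y => cosLaw x y t) (2 * y - 2 * x * t) y := by
    unfold cosLaw
    refine ((((hasDerivAt_pow 2 y).const_add (x ^ 2))).sub
      (((hasDerivAt_id y).const_mul (2 * x)).mul_const t)).congr_deriv ?_
    simp
  refine ((hasDerivAt_sqK l (cosLaw_pos hy hyx ht)).comp y h1).congr_deriv ?_
  ring

lemma hasDerivAt_sqK_cosLaw_x (l : ℕ) {x y t : ℝ} (hy : 0 < y) (hyx : y < x)
    (ht : t ∈ Set.Icc (-1 : ℝ) 1) :
    HasDerivAt (fun x => sqK l (cosLaw x y t)) (sqK (l + 1) (cosLaw x y t) * (y * t - x)) x := by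
  have h1 : HasDerivAt (fun x => cosLaw x y t) (2 * x - 2 * y * t) x := by
    unfold cosLaw
    refine ((((hasDerivAt_pow 2 x).add_const (y ^ 2))).sub
      ((((hasDerivAt_id x).const_mul 2).mul_const y).mul_const t)).congr_deriv ?_
    simp
  refine ((hasDerivAt_sqK l (cosLaw_pos hy hyx ht)).comp x h1).congr_deriv ?_
  ring

/-- The spherical mean value of `k_ℓ(w)/w^ℓ` in dimension `2ℓ+3`. -/
theorem integral_pow_mul_sqK (l : ℕ) {x y : ℝ} (hy : 0 < y) (hyx : y < x) :
    ∫ t in (-1 : ℝ)..1, (1 - t ^ 2) ^ l * sqK l (cosLaw x y t) =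
      2 * 2 ^ l * (l ! : ℝ) * redI l y * redK l x := by
  have hle : (-1 : ℝ) ≤ 1 := by norm_num
  -- The inductive step differentiates the identity in `x` and `y`, so it must be available near the
  -- given radii.
  induction l generalizing x y with
  | zero =>
    have hx : 0 < x := hy.trans hyx
    have h1 : ∀ t ∈ Set.uIcc (-1 : ℝ) 1, HasDerivAt
        (fun t => Real.exp (-Real.sqrt (cosLaw x y t)) / (x * y))
        ((1 - t ^ 2) ^ 0 * sqK 0 (cosLaw x y t)) t := by
      intro t ht
      rw [Set.uIcc_of_le hle] at ht
      have h0 := cosLaw_pos hy hyx ht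
      have h2 : HasDerivAt (fun t => cosLaw x y t) (-(2 * x * y)) t := by
        unfold cosLaw
        simpa using ((hasDerivAt_id t).const_mul (2 * x * y)).const_sub (x ^ 2 + y ^ 2)
      refine (((h2.sqrt h0.ne').neg.exp).div_const (x * y)).congr_deriv ?_
      have := Real.sqrt_pos.2 h0
      rw [sqK, redK_zero]
      field_simp
      rfl
    rw [intervalIntegral.integral_eq_sub_of_hasDerivAt h1]
    · have e1 : cosLaw x y 1 = (x - y) ^ 2 := by rw [cosLaw]; ring
      have e2 : cosLaw x y (-1) = (x + y) ^ 2 := by rw [cosLaw]; ring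
      rw [e1, e2, Real.sqrt_sq (by linarith), Real.sqrt_sq (by linarith), redI_zero hy.ne',
        redK_zero, Real.sinh_eq, neg_sub, neg_add, sub_eq_add_neg y x, Real.exp_add, Real.exp_add]
      simp
      field_simp
    · refine ContinuousOn.intervalIntegrable_of_Icc hle (ContinuousOn.mul (by fun_prop) ?_)
      exact continuousOn_sqK_cosLaw 0 (by fun_prop) (by fun_prop) (by fun_prop)
        fun t ht => ⟨hy, hyx, ht⟩
  | succ l ih =>
    have hD1 : ∀ x y : ℝ, 0 < y → y < x →
        ∫ t in (-1 : ℝ)..1, (1 - t ^ 2) ^ l * (sqK (l + 1) (cosLaw x y t) * (x * t - y)) =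
          2 * 2 ^ l * (l ! : ℝ) * (y * redI (l + 1) y) * redK l x := by
      intro x y hy hyx
      have h1 := hasDerivAt_intervalIntegral_param (U := Set.Ioo 0 x) isOpen_Ioo hle
        (f := fun y t => (1 - t ^ 2) ^ l * sqK l (cosLaw x y t))
        (f' := fun y t => (1 - t ^ 2) ^ l * (sqK (l + 1) (cosLaw x y t) * (x * t - y)))
        (fun y hy => ContinuousOn.mul (by fun_prop) (continuousOn_sqK_cosLaw l (by fun_prop)
          (by fun_prop) (by fun_prop) fun t ht => ⟨hy.1, hy.2, ht⟩))
        (fun y hy t ht => (hasDerivAt_sqK_cosLaw_y l hy.1 hy.2 ht).const_mul _)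
        (ContinuousOn.mul (by fun_prop) (ContinuousOn.mul (continuousOn_sqK_cosLaw _ (by fun_prop)
          (by fun_prop) (by fun_prop) fun p hp => ⟨hp.1.1, hp.1.2, hp.2⟩) (by fun_prop)))
        (x₀ := y) ⟨hy, hyx⟩
      have h2 : HasDerivAt (fun y => 2 * 2 ^ l * (l ! : ℝ) * redI l y * redK l x)
          (2 * 2 ^ l * (l ! : ℝ) * (y * redI (l + 1) y) * redK l x) y :=
        ((hasDerivAt_redI l hy).const_mul _).mul_const _
      refine h1.unique (h2.congr_of_eventuallyEq ?_)
      filter_upwards [isOpen_Ioo.mem_nhds (show y ∈ Set.Ioo 0 x from ⟨hy, hyx⟩)] with v hv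
      exact ih hv.1 hv.2
    have hx : 0 < x := hy.trans hyx
    have hD2 : ∫ t in (-1 : ℝ)..1, (1 - t ^ 2) ^ l *
        (sqK (l + 2) (cosLaw x y t) * (y * t - x) * (x * t - y) + sqK (l + 1) (cosLaw x y t) * t) =
          2 * 2 ^ l * (l ! : ℝ) * (y * redI (l + 1) y) * (-x * redK (l + 1) x) := by
      have h1 := hasDerivAt_intervalIntegral_param (U := Set.Ioi y) isOpen_Ioi hle
        (f := fun x t => (1 - t ^ 2) ^ l * (sqK (l + 1) (cosLaw x y t) * (x * t - y)))
        (f' := fun x t => (1 - t ^ 2) ^ l * (sqK (l + 2) (cosLaw x y t) * (y * t - x) * (x * t - y) +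
          sqK (l + 1) (cosLaw x y t) * t))
        (fun x hx => ContinuousOn.mul (by fun_prop) (ContinuousOn.mul (continuousOn_sqK_cosLaw _
          (by fun_prop) (by fun_prop) (by fun_prop) fun t ht => ⟨hy, hx, ht⟩) (by fun_prop)))
        (fun x hx t ht => ((hasDerivAt_sqK_cosLaw_x (l + 1) hy hx ht).mul
          (by simpa using ((hasDerivAt_id x).mul_const t).sub_const y)).const_mul _)
        (ContinuousOn.mul (by fun_prop) (ContinuousOn.add (ContinuousOn.mul (ContinuousOn.mul
          (continuousOn_sqK_cosLaw _ (by fun_prop) (by fun_prop) (by fun_prop)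
            fun p hp => ⟨hy, hp.1, hp.2⟩) (by fun_prop)) (by fun_prop)) (ContinuousOn.mul
          (continuousOn_sqK_cosLaw _ (by fun_prop) (by fun_prop) (by fun_prop)
            fun p hp => ⟨hy, hp.1, hp.2⟩) (by fun_prop))))
        (x₀ := x) hyx
      have h2 : HasDerivAt (fun x => 2 * 2 ^ l * (l ! : ℝ) * (y * redI (l + 1) y) * redK l x)
          (2 * 2 ^ l * (l ! : ℝ) * (y * redI (l + 1) y) * (-x * redK (l + 1) x)) x :=
        (hasDerivAt_redK l hx).const_mul _
      refine h1.unique (h2.congr_of_eventuallyEq ?_)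
      filter_upwards [isOpen_Ioi.mem_nhds (show x ∈ Set.Ioi y from hyx)] with v hv
      exact hD1 v y hy hv
    have hc : ∀ j, ContinuousOn (fun t => sqK j (cosLaw x y t)) (Set.Icc (-1 : ℝ) 1) := fun j =>
      continuousOn_sqK_cosLaw j (by fun_prop) (by fun_prop) (by fun_prop)
        fun t ht => ⟨hy, hyx, ht⟩
    -- This is the derivative of `(1-t²)^(l+1) (sqK (l+1) + sqK l / (2(l+1)))`, which vanishes at
    -- `±1`. By `sqK_rec`, the integrand of the mixed derivative in `hD2` is `g'` minus
    -- `xy/(2(l+1))` times the integrand wanted at level `l+1`.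
    set g' : ℝ → ℝ := fun t => ((l + 1 : ℕ) : ℝ) * (1 - t ^ 2) ^ l * (-(2 * t)) *
        (sqK (l + 1) (cosLaw x y t) + sqK l (cosLaw x y t) / (2 * (l + 1))) +
      (1 - t ^ 2) ^ (l + 1) * (x * y * sqK (l + 2) (cosLaw x y t) +
        x * y * sqK (l + 1) (cosLaw x y t) / (2 * (l + 1))) with hg'
    have hint : IntervalIntegrable g' volume (-1) 1 := by
      refine ContinuousOn.intervalIntegrable_of_Icc hle ?_
      have := hc l
      have := hc (l + 1)
      have := hc (l + 2)
      rw [hg']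
      fun_prop
    have hg : ∫ t in (-1 : ℝ)..1, g' t = 0 := by
      rw [intervalIntegral.integral_eq_sub_of_hasDerivAt (f := fun t => (1 - t ^ 2) ^ (l + 1) *
        (sqK (l + 1) (cosLaw x y t) + sqK l (cosLaw x y t) / (2 * (l + 1)))) _ hint]
      · simp
      · intro t ht
        rw [Set.uIcc_of_le hle] at ht
        have h1 : HasDerivAt (fun t : ℝ => (1 - t ^ 2) ^ (l + 1))
            (((l + 1 : ℕ) : ℝ) * (1 - t ^ 2) ^ l * (-(2 * t))) t := by
          refine (((hasDerivAt_pow 2 t).const_sub 1).pow (l + 1)).congr_deriv ?_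
          simp
        exact h1.mul ((hasDerivAt_sqK_cosLaw_t (l + 1) hy hyx ht).add
          ((hasDerivAt_sqK_cosLaw_t l hy hyx ht).div_const _))
    have hM : IntervalIntegrable (fun t => (1 - t ^ 2) ^ (l + 1) * sqK (l + 1) (cosLaw x y t))
        volume (-1) 1 := by
      refine ContinuousOn.intervalIntegrable_of_Icc hle ?_
      have := hc (l + 1)
      fun_prop
    have hfin : ∫ t in (-1 : ℝ)..1, (1 - t ^ 2) ^ l *
        (sqK (l + 2) (cosLaw x y t) * (y * t - x) * (x * t - y) + sqK (l + 1) (cosLaw x y t) * t) =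
        ∫ t in (-1 : ℝ)..1, (g' t - x * y / (2 * (l + 1)) *
          ((1 - t ^ 2) ^ (l + 1) * sqK (l + 1) (cosLaw x y t))) := by
      refine intervalIntegral.integral_congr fun t ht => ?_
      rw [Set.uIcc_of_le hle] at ht
      have h1 := sqK_rec l (cosLaw_pos hy hyx ht)
      have h2 : sqK l (cosLaw x y t) = (x ^ 2 + y ^ 2 - 2 * x * y * t) * sqK (l + 2) (cosLaw x y t)
        - (2 * l + 3) * sqK (l + 1) (cosLaw x y t) := by rw [← cosLaw]; linarith
      simp only [hg', h2, pow_succ]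
      push_cast
      field_simp
      ring
    rw [hfin, intervalIntegral.integral_sub hint (hM.const_mul _), hg,
      intervalIntegral.integral_const_mul, zero_sub] at hD2
    have hxy : x * y / (2 * (l + 1)) ≠ 0 := by positivity
    apply mul_left_cancel₀ hxy
    rw [← neg_inj, hD2, pow_succ, Nat.factorial_succ]
    push_cast
    field_simp

/-! ### Orthogonality and completeness of Legendre polynomials. -/

-- `(X² - 1)^l` has zeros of order `l` at `±1`; this kills the boundary terms in the integrations by
-- parts.
open Polynomial in
lemma iterate_derivative_sq_sub_one_eval {l j : ℕ} (hj : j < l) {t : ℝ} (ht : t ^ 2 = 1) :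
    (derivative^[j] ((X ^ 2 - 1 : Polynomial ℝ) ^ l)).eval t = 0 := by
  obtain ⟨q, hq⟩ := pow_sub_dvd_iterate_derivative_pow (X ^ 2 - 1 : Polynomial ℝ) l j
  rw [hq, eval_mul, eval_pow]
  simp [ht, Nat.sub_ne_zero_of_lt hj]

open Polynomial in
lemma integral_mul_iterate_derivative {f : ℕ → ℝ → ℝ}
    (hf : ∀ j, ∀ t ∈ Set.Icc (-1 : ℝ) 1, HasDerivAt (f j) (f (j + 1) t) t) (l k : ℕ) (hk : k ≤ l) :
    ∫ t in (-1 : ℝ)..1, f 0 t * (derivative^[l] ((X ^ 2 - 1 : Polynomial ℝ) ^ l)).eval t =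
      (-1) ^ k *
        ∫ t in (-1 : ℝ)..1, f k t * (derivative^[l - k] ((X ^ 2 - 1 : Polynomial ℝ) ^ l)).eval t := by
  have hle : (-1 : ℝ) ≤ 1 := by norm_num
  induction k with
  | zero => simp
  | succ k ih =>
    rw [ih (by omega)]
    have e : l - k = (l - (k + 1)) + 1 := by omega
    have hc : ContinuousOn (f (k + 1)) (Set.Icc (-1) 1) := fun t ht =>
      (hf (k + 1) t ht).continuousAt.continuousWithinAt
    rw [e, Function.iterate_succ_apply', intervalIntegral.integral_mul_deriv_eq_deriv_mul
      (u := f k) (v := fun t => (derivative^[l - (k + 1)] ((X ^ 2 - 1 : Polynomial ℝ) ^ l)).eval t)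
      (u' := f (k + 1))
      (fun t ht => hf k t (by rwa [Set.uIcc_of_le hle] at ht))
      (fun t _ => Polynomial.hasDerivAt _ t) (hc.intervalIntegrable_of_Icc hle)
      ((Polynomial.continuous _).intervalIntegrable _ _)]
    rw [iterate_derivative_sq_sub_one_eval (by omega) (by norm_num),
      iterate_derivative_sq_sub_one_eval (by omega) (by norm_num), pow_succ]
    ring

/-- Repeated integration by parts against a Legendre polynomial. -/
lemma integral_mul_legendre {f : ℕ → ℝ → ℝ}
    (hf : ∀ j, ∀ t ∈ Set.Icc (-1 : ℝ) 1, HasDerivAt (f j) (f (j + 1) t) t) (l : ℕ) :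
    ∫ t in (-1 : ℝ)..1, f 0 t * (legendre l).eval t =
      1 / (2 ^ l * (l ! : ℝ)) * ∫ t in (-1 : ℝ)..1, (1 - t ^ 2) ^ l * f l t := by
  have h := integral_mul_iterate_derivative hf l l le_rfl
  have h1 : ∀ t, f 0 t * (legendre l).eval t = 1 / (2 ^ l * (l ! : ℝ)) * (f 0 t *
      (Polynomial.derivative^[l] ((Polynomial.X ^ 2 - 1 : Polynomial ℝ) ^ l)).eval t) := by
    intro t
    rw [legendre, Polynomial.eval_mul, Polynomial.eval_C]
    ring
  simp only [h1]
  rw [intervalIntegral.integral_const_mul, h, ← intervalIntegral.integral_const_mul]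
  congr 2
  ext t
  have h2 : (1 - t ^ 2) ^ l = (-1) ^ l * (t ^ 2 - 1) ^ l := by rw [← mul_pow]; ring
  rw [h2]
  simp
  ring

/-- The Legendre coefficients of the Yukawa kernel. -/
lemma integral_sqK_mul_legendre (l : ℕ) {x y : ℝ} (hy : 0 < y) (hyx : y < x) :
    ∫ t in (-1 : ℝ)..1, sqK 0 (cosLaw x y t) * (legendre l).eval t =
      2 * besselI l y * besselK l x := by
  have hx : 0 < x := hy.trans hyx
  have h := integral_mul_legendre (f := fun j t => (x * y) ^ j * sqK j (cosLaw x y t))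
    (fun j t ht => ((hasDerivAt_sqK_cosLaw_t j hy hyx ht).const_mul ((x * y) ^ j)).congr_deriv
      (by ring)) l
  simp only [pow_zero, one_mul, mul_left_comm _ ((x * y) ^ l)] at h
  rw [h, intervalIntegral.integral_const_mul, integral_pow_mul_sqK l hy hyx, besselI_eq, redK]
  field_simp
  ring

/-- The recurrence in `l` comes from integrating the derivative of `t (1-t²)^(l+1)`. -/
lemma integral_one_sub_sq_pow (l : ℕ) :
    ∫ t in (-1 : ℝ)..1, (1 - t ^ 2) ^ l =
      2 * (2 ^ l * (l ! : ℝ)) ^ 2 / ((2 * l + 1)! : ℝ) := by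
  have hle : (-1 : ℝ) ≤ 1 := by norm_num
  induction l with
  | zero => norm_num
  | succ l ih =>
    have h1 : ∫ t in (-1 : ℝ)..1, ((2 * l + 3) * (1 - t ^ 2) ^ (l + 1) -
        2 * (l + 1) * (1 - t ^ 2) ^ l) = 0 := by
      rw [intervalIntegral.integral_eq_sub_of_hasDerivAt
        (f := fun t : ℝ => t * (1 - t ^ 2) ^ (l + 1))]
      · simp
      · intro t _
        refine ((hasDerivAt_id t).mul
          (((hasDerivAt_pow 2 t).const_sub 1).pow (l + 1))).congr_deriv ?_
        simp
        ring
      · exact Continuous.intervalIntegrable (by fun_prop) _ _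
    rw [intervalIntegral.integral_sub (Continuous.intervalIntegrable (by fun_prop) _ _)
      (Continuous.intervalIntegrable (by fun_prop) _ _), intervalIntegral.integral_const_mul,
      intervalIntegral.integral_const_mul, ih] at h1
    have h2 : (2 * l + 3 : ℝ) ≠ 0 := by positivity
    have e : 2 * (l + 1) + 1 = (2 * l + 1) + 1 + 1 := by ring
    apply mul_left_cancel₀ h2
    rw [sub_eq_zero.1 h1, e, Nat.factorial_succ (2 * l + 1 + 1), Nat.factorial_succ (2 * l + 1),
      Nat.factorial_succ l]
    push_cast
    field_simp
    ring

open Polynomial in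
lemma integral_poly_mul_legendre (p : Polynomial ℝ) (l : ℕ) :
    ∫ t in (-1 : ℝ)..1, p.eval t * (legendre l).eval t =
      1 / (2 ^ l * (l ! : ℝ)) * ∫ t in (-1 : ℝ)..1, (1 - t ^ 2) ^ l * (derivative^[l] p).eval t := by
  refine integral_mul_legendre (f := fun j t => (derivative^[j] p).eval t) (fun j t _ => ?_) l
  rw [Function.iterate_succ_apply']
  exact Polynomial.hasDerivAt _ t

open Polynomial in
lemma natDegree_legendre_le (l : ℕ) : (legendre l).natDegree ≤ l := by
  refine (natDegree_C_mul_le _ _).trans ((natDegree_iterate_derivative _ _).trans ?_)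
  have h : ((X ^ 2 - 1 : Polynomial ℝ) ^ l).natDegree ≤ l * 2 :=
    natDegree_pow_le_of_le l (by compute_degree)
  omega

open Polynomial in
lemma coeff_legendre (l : ℕ) :
    (legendre l).coeff l = ((2 * l)! : ℝ) / (2 ^ l * (l ! : ℝ) ^ 2) := by
  have h1 : (X ^ 2 - 1 : Polynomial ℝ).natDegree ≤ 2 := by compute_degree
  have h2 := coeff_pow_of_natDegree_le (m := l) h1
  have h3 := Nat.factorial_mul_descFactorial (by omega : l ≤ l + l)
  have e : l + l - l = l := by omega
  rw [e] at h3
  rw [legendre, coeff_C_mul, coeff_iterate_derivative, ← two_mul, mul_comm 2 l, h2, mul_comm l 2,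
    two_mul l, ← h3]
  simp [coeff_one]
  field_simp

lemma integral_legendre_mul_of_lt {j l : ℕ} (h : j < l) :
    ∫ t in (-1 : ℝ)..1, (legendre j).eval t * (legendre l).eval t = 0 := by
  rw [integral_poly_mul_legendre, Polynomial.iterate_derivative_eq_zero
    ((natDegree_legendre_le j).trans_lt h)]
  simp

lemma integral_legendre_mul (j l : ℕ) :
    ∫ t in (-1 : ℝ)..1, (legendre j).eval t * (legendre l).eval t =
      (if j = l then 2 / (2 * l + 1) else 0 : ℝ) := by
  rcases lt_trichotomy j l with h | rfl | h
  · rw [if_neg h.ne, integral_legendre_mul_of_lt h]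
  · rw [if_pos rfl, integral_poly_mul_legendre]
    have h1 : Polynomial.derivative^[j] (legendre j) =
        Polynomial.C (((2 * j)! : ℝ) / (2 ^ j * (j ! : ℝ))) := by
      rw [Polynomial.eq_C_of_natDegree_le_zero
        ((Polynomial.natDegree_iterate_derivative (legendre j) j).trans
          (by have := natDegree_legendre_le j; omega)),
        Polynomial.coeff_iterate_derivative, zero_add, coeff_legendre, Nat.descFactorial_self]
      congr 1
      simp
      field_simp
    simp only [h1, Polynomial.eval_C]
    rw [intervalIntegral.integral_mul_const, integral_one_sub_sq_pow, Nat.factorial_succ]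
    push_cast
    field_simp
  · rw [if_neg h.ne']
    simp only [mul_comm (Polynomial.eval _ (legendre j))]
    exact integral_legendre_mul_of_lt h

/-- Completeness of the Legendre polynomials. -/
lemma eqOn_zero_of_integral_mul_legendre {f : ℝ → ℝ} (hf : ContinuousOn f (Set.Icc (-1) 1))
    (h : ∀ l, ∫ t in (-1 : ℝ)..1, f t * (legendre l).eval t = 0) :
    ∀ t ∈ Set.Icc (-1 : ℝ) 1, f t = 0 := by
  have hle : (-1 : ℝ) ≤ 1 := by norm_num
  have hI : ∀ p : Polynomial ℝ, IntervalIntegrable (fun t => f t * p.eval t) volume (-1) 1 :=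
    fun p => ContinuousOn.intervalIntegrable_of_Icc hle (hf.mul p.continuousOn)
  -- Orthogonality to every polynomial: a multiple of `legendre n` removes the coefficient of degree
  -- `n`.
  have hp : ∀ n : ℕ, ∀ p : Polynomial ℝ, p.natDegree < n →
      ∫ t in (-1 : ℝ)..1, f t * p.eval t = 0 := by
    intro n
    induction n with
    | zero => intro p hp; omega
    | succ n ih =>
      intro p hp
      set c := p.coeff n / (legendre n).coeff n
      have hc : (legendre n).coeff n ≠ 0 := by rw [coeff_legendre]; positivity
      set q := p - Polynomial.C c * legendre n with hq
      have hqn : q.natDegree ≤ n := by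
        refine (Polynomial.natDegree_sub_le _ _).trans (max_le (by omega) ?_)
        exact (Polynomial.natDegree_C_mul_le _ _).trans (natDegree_legendre_le n)
      have hq0 : q.coeff n = 0 := by
        rw [hq, Polynomial.coeff_sub, Polynomial.coeff_C_mul, div_mul_cancel₀ _ hc, sub_self]
      have hpq : ∀ t, f t * p.eval t = f t * q.eval t + c * (f t * (legendre n).eval t) := by
        intro t
        rw [hq, Polynomial.eval_sub, Polynomial.eval_mul, Polynomial.eval_C]
        ring
      simp only [hpq]
      rw [intervalIntegral.integral_add (hI _) ((hI _).const_mul _),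
        intervalIntegral.integral_const_mul, h, mul_zero, add_zero]
      rcases Nat.eq_zero_or_pos n with rfl | hn
      · rw [Polynomial.eq_C_of_natDegree_le_zero hqn, hq0]
        simp
      · apply ih
        rcases hqn.lt_or_eq with h1 | h1
        · exact h1
        · have : q = 0 := by rw [← Polynomial.leadingCoeff_eq_zero, Polynomial.leadingCoeff, h1, hq0]
          rw [this]
          simpa using hn
  have hff : IntervalIntegrable (fun t => f t * f t) volume (-1) 1 :=
    ContinuousOn.intervalIntegrable_of_Icc hle (hf.mul hf)
  have hsq : ∫ t in (-1 : ℝ)..1, f t * f t = 0 := by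
    obtain ⟨C, hC⟩ := isCompact_Icc.exists_bound_of_continuousOn hf
    have hC0 : 0 ≤ C := (norm_nonneg _).trans (hC 1 (by norm_num))
    by_contra hne
    have hpos : 0 < |∫ t in (-1 : ℝ)..1, f t * f t| := abs_pos.2 hne
    -- A polynomial within `ε` of `f` bounds the integral by `2Cε`, whereas this choice makes it
    -- equal to `4(C+1)ε`.
    set ε := |∫ t in (-1 : ℝ)..1, f t * f t| / (4 * (C + 1)) with hε
    have hε0 : 0 < ε := by positivity
    obtain ⟨p, hpε⟩ := exists_polynomial_near_of_continuousOn (-1) 1 f hf ε hε0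
    have h1 : ∫ t in (-1 : ℝ)..1, f t * f t = ∫ t in (-1 : ℝ)..1, (f t * f t - f t * p.eval t) := by
      rw [intervalIntegral.integral_sub hff (hI p), hp _ p (Nat.lt_succ_self _), sub_zero]
    have h2 : ‖∫ t in (-1 : ℝ)..1, (f t * f t - f t * p.eval t)‖ ≤ (C * ε) * |1 - (-1)| := by
      refine intervalIntegral.norm_integral_le_of_norm_le_const fun t ht => ?_
      rw [Set.uIoc_of_le hle] at ht
      have ht' := Set.Ioc_subset_Icc_self ht
      rw [← mul_sub, norm_mul]
      refine mul_le_mul (hC t ht') ?_ (norm_nonneg _) hC0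
      rw [norm_sub_rev]
      exact (hpε t ht').le
    rw [← h1, Real.norm_eq_abs] at h2
    have h3 : |∫ t in (-1 : ℝ)..1, f t * f t| = ε * (4 * (C + 1)) := by
      rw [hε]; field_simp
    rw [h3] at h2
    norm_num at h2
    nlinarith
  by_contra! hne
  obtain ⟨t, ht, hft⟩ := hne
  have := intervalIntegral.integral_pos (by norm_num) (hf.mul hf)
    (fun t _ => mul_self_nonneg (f t)) ⟨t, ht, mul_self_pos.2 hft⟩
  exact this.ne' hsq

/-! ### The Legendre series of the kernel. -/

/-- Gegenbauer's addition theorem for the Yukawa kernel. -/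
theorem hasSum_yukawa_legendre {x y t : ℝ} (hy : 0 < y) (hyx : y < x)
    (ht : t ∈ Set.Icc (-1 : ℝ) 1) :
    HasSum (fun l : ℕ => (2 * l + 1) * besselI l y * besselK l x * (legendre l).eval t)
      (sqK 0 (cosLaw x y t)) := by
  have hle : (-1 : ℝ) ≤ 1 := by norm_num
  have hx : 0 < x := hy.trans hyx
  set a : ℕ → ℝ := fun l => (2 * l + 1) * besselI l y * besselK l x with ha
  have ha0 : ∀ l, 0 ≤ a l := fun l =>
    mul_nonneg (mul_nonneg (by positivity) (besselI_nonneg l hy.le)) (besselK_nonneg l hx)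
  have hsum : Summable a := by
    refine Summable.of_nonneg_of_le ha0 (fun l => besselI_mul_besselK_le l hy.le le_rfl hx) ?_
    exact (summable_geometric_of_lt_one (by positivity) ((div_lt_one hx).2 hyx)).mul_left _
  have hb : ∀ l, ∀ t ∈ Set.Icc (-1 : ℝ) 1, ‖a l * (legendre l).eval t‖ ≤ a l := by
    intro l t ht
    rw [norm_mul, Real.norm_of_nonneg (ha0 l)]
    exact mul_le_of_le_one_right (ha0 l) (abs_legendre_le ht l)
  set H : ℝ → ℝ := fun t => ∑' l, a l * (legendre l).eval t with hH
  have hHs : ∀ t ∈ Set.Icc (-1 : ℝ) 1, HasSum (fun l => a l * (legendre l).eval t) (H t) :=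
    fun t ht => (Summable.of_norm_bounded hsum fun l => hb l t ht).hasSum
  have hHc : ContinuousOn H (Set.Icc (-1) 1) :=
    continuousOn_tsum (fun l => (by fun_prop : Continuous _).continuousOn) hsum hb
  have hGc : ContinuousOn (fun t => sqK 0 (cosLaw x y t)) (Set.Icc (-1 : ℝ) 1) :=
    continuousOn_sqK_cosLaw 0 (by fun_prop) (by fun_prop) (by fun_prop) fun t ht => ⟨hy, hyx, ht⟩
  -- Termwise integration with the constants `a l` as dominating functions; orthogonality keeps only
  -- the term `l = j`.
  have hHj : ∀ j, ∫ t in (-1 : ℝ)..1, H t * (legendre j).eval t = 2 * besselI j y * besselK j x := by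
    intro j
    have h1 := intervalIntegral.hasSum_integral_of_dominated_convergence (μ := volume)
      (a := -1) (b := 1) (F := fun l t => a l * (legendre l).eval t * (legendre j).eval t)
      (f := fun t => H t * (legendre j).eval t) (fun l _ => a l)
      (fun l => (by fun_prop : Continuous _).aestronglyMeasurable)
      (fun l => Filter.Eventually.of_forall fun t ht => by
        rw [Set.uIoc_of_le hle] at ht
        have ht' := Set.Ioc_subset_Icc_self ht
        rw [norm_mul]
        exact (mul_le_of_le_one_right (norm_nonneg _) (abs_legendre_le ht' j)).trans (hb l t ht'))
      (Filter.Eventually.of_forall fun t _ => hsum)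
      intervalIntegrable_const
      (Filter.Eventually.of_forall fun t ht => by
        rw [Set.uIoc_of_le hle] at ht
        exact (hHs t (Set.Ioc_subset_Icc_self ht)).mul_right _)
    have h2 : ∀ l, ∫ t in (-1 : ℝ)..1, a l * (legendre l).eval t * (legendre j).eval t =
        if l = j then 2 * besselI j y * besselK j x else 0 := by
      intro l
      simp only [mul_assoc (a l)]
      rw [intervalIntegral.integral_const_mul, integral_legendre_mul]
      split_ifs with h
      · subst h
        rw [ha]
        field_simp
      · simp
    simp only [h2] at h1
    exact h1.unique (hasSum_ite_eq j _)
  have key := eqOn_zero_of_integral_mul_legendre (f := fun t => sqK 0 (cosLaw x y t) - H t)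
    (hGc.sub hHc) (fun l => by
    simp only [sub_mul]
    rw [intervalIntegral.integral_sub, integral_sqK_mul_legendre l hy hyx, hHj, sub_self]
    · exact ContinuousOn.intervalIntegrable_of_Icc hle (hGc.mul (Polynomial.continuousOn _))
    · exact ContinuousOn.intervalIntegrable_of_Icc hle (hHc.mul (Polynomial.continuousOn _))) t ht
  rw [sub_eq_zero.1 key]
  exact hHs t ht

/-! ### Expansion of the kernel in spherical harmonics. -/

/-- The index set of spherical harmonics, fibred over the degree. -/
def indexEquiv : (Σ l : ℕ, Fin (2 * l + 1)) ≃ Index where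
  toFun p := ⟨(p.1, ((p.2 : ℕ) : ℤ) - p.1), by
    have := p.2.2
    rw [abs_le]
    constructor <;> dsimp only <;> omega⟩
  invFun L := ⟨L.1.1, ⟨(L.1.2 + L.1.1).toNat, by
    have := abs_le.1 L.2
    omega⟩⟩
  left_inv p := by
    obtain ⟨l, k, hk⟩ := p
    simp
  right_inv L := by
    obtain ⟨⟨l, m⟩, h⟩ := L
    have := abs_le.1 h
    dsimp only at this ⊢
    ext
    · rfl
    · dsimp only
      omega

lemma summable_of_degree_bound {B : ℕ → ℝ} (hB : ∀ l, 0 ≤ B l)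
    (h : Summable fun l : ℕ => (2 * l + 1 : ℝ) * B l) :
    Summable fun L : Index => B L.1.1 := by
  rw [← indexEquiv.summable_iff]
  change Summable fun p : (Σ l : ℕ, Fin (2 * l + 1)) => B p.1
  rw [summable_sigma_of_nonneg fun p => hB p.1]
  refine ⟨fun l => Summable.of_finite, h.congr fun l => ?_⟩
  rw [tsum_fintype]
  simp

/-- The term of index `L` of the expansion of the Yukawa kernel. -/
def kernelTerm (lam : ℝ) (x y : E3) (L : Index) : ℂ :=
  4 * (Real.pi : ℂ) * (lam : ℂ) * (besselI L.1.1 (lam * ‖y‖) : ℂ) *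
    (besselK L.1.1 (lam * ‖x‖) : ℂ) * sphericalHarmonic L.1.1 L.1.2 (unitVec x) *
    (starRingEnd ℂ) (sphericalHarmonic L.1.1 L.1.2 (unitVec y))

lemma norm_unitVec {x : E3} (hx : x ≠ 0) : ‖unitVec x‖ = 1 := by
  rw [unitVec, norm_smul, norm_inv, norm_norm, inv_mul_cancel₀ (norm_ne_zero_iff.2 hx)]

lemma norm_sphericalHarmonic_index_le {u : E3} (hu : ‖u‖ = 1) (L : Index) :
    ‖sphericalHarmonic L.1.1 L.1.2 u‖ ≤ Real.sqrt ((2 * L.1.1 + 1) / (4 * Real.pi)) := by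
  obtain ⟨⟨l, k⟩, rfl⟩ := indexEquiv.surjective L
  exact norm_sphericalHarmonic_le hu k.2

/-- The bound for the terms of degree `l` of the kernel expansion on the ball of radius `R`. -/
def kernelBound (lam R : ℝ) (x : E3) (l : ℕ) : ℝ :=
  Real.exp ((lam * R) ^ 2 / 2) / ‖x‖ * (R / ‖x‖) ^ l

lemma summable_kernelBound (lam : ℝ) {R : ℝ} (hR : 0 < R) {x : E3} (hx : R < ‖x‖) :
    Summable fun L : Index => kernelBound lam R x L.1.1 := by
  have hx0 : 0 < ‖x‖ := hR.trans hx
  refine summable_of_degree_bound (fun l => by unfold kernelBound; positivity) ?_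
  have hq : ‖R / ‖x‖‖ < 1 := by
    rw [Real.norm_of_nonneg (by positivity)]
    exact (div_lt_one hx0).2 hx
  have h1 := (summable_pow_mul_geometric_of_norm_lt_one 1 hq).mul_left 2
  have h2 := (h1.add (summable_geometric_of_norm_lt_one hq)).mul_left
    (Real.exp ((lam * R) ^ 2 / 2) / ‖x‖)
  refine h2.congr fun l => ?_
  rw [kernelBound]
  ring

/-- The two harmonics contribute at most `(2l+1)/(4π)`, the factor that `besselI_mul_besselK_le`
absorbs. The bound does not depend on `y`, which makes it usable under the integral. -/
lemma norm_kernelTerm_le {lam R : ℝ} (hlam : 0 < lam) {x y : E3} (hx : x ≠ 0) (hy : y ≠ 0)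
    (hyR : ‖y‖ ≤ R) (L : Index) : ‖kernelTerm lam x y L‖ ≤ kernelBound lam R x L.1.1 := by
  obtain ⟨⟨l, m⟩, hL⟩ := L
  have hx0 : 0 < ‖x‖ := norm_pos_iff.2 hx
  have h1 := norm_sphericalHarmonic_index_le (norm_unitVec hx) ⟨(l, m), hL⟩
  have h2 := norm_sphericalHarmonic_index_le (norm_unitVec hy) ⟨(l, m), hL⟩
  have hI := besselI_nonneg l (y := lam * ‖y‖) (by positivity)
  have hK := besselK_nonneg l (x := lam * ‖x‖) (by positivity)
  have h3 := besselI_mul_besselK_le l (y := lam * ‖y‖) (Y := lam * R) (x := lam * ‖x‖)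
    (by positivity) (by gcongr) (by positivity)
  have h4 := mul_le_mul h1 h2 (norm_nonneg _) (Real.sqrt_nonneg _)
  rw [Real.mul_self_sqrt (by positivity)] at h4
  dsimp only at h1 h2 h4
  simp only [kernelTerm, norm_mul, RCLike.norm_conj, Complex.norm_real, Real.norm_eq_abs,
    abs_of_nonneg hI, abs_of_nonneg hK, abs_of_pos hlam, abs_of_pos Real.pi_pos]
  calc _ = 4 * Real.pi * lam * besselI l (lam * ‖y‖) * besselK l (lam * ‖x‖) *
        (‖sphericalHarmonic l m (unitVec x)‖ * ‖sphericalHarmonic l m (unitVec y)‖) := by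
        simp only [Complex.norm_ofNat]
        ring
    _ ≤ 4 * Real.pi * lam * besselI l (lam * ‖y‖) * besselK l (lam * ‖x‖) *
        ((2 * l + 1) / (4 * Real.pi)) := mul_le_mul_of_nonneg_left h4 (by positivity)
    _ = lam * ((2 * l + 1) * besselI l (lam * ‖y‖) * besselK l (lam * ‖x‖)) := by
        have := Real.pi_pos
        field_simp
    _ ≤ lam * (Real.exp ((lam * R) ^ 2 / 2) / (lam * ‖x‖) * (lam * R / (lam * ‖x‖)) ^ l) :=
        mul_le_mul_of_nonneg_left h3 hlam.le
    _ = _ := by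
        rw [mul_div_mul_left _ _ hlam.ne', kernelBound]
        field_simp

lemma green_eq_sqK {lam : ℝ} (hlam : 0 < lam) {x y : E3} (hx : x ≠ 0) (hy : y ≠ 0) :
    green lam x y = lam * sqK 0 (cosLaw (lam * ‖x‖) (lam * ‖y‖)
      (inner ℝ (unitVec x) (unitVec y))) := by
  have hx0 := norm_ne_zero_iff.2 hx
  have hy0 := norm_ne_zero_iff.2 hy
  have h1 : cosLaw (lam * ‖x‖) (lam * ‖y‖) (inner ℝ (unitVec x) (unitVec y)) =
      (lam * ‖x - y‖) ^ 2 := by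
    rw [cosLaw, unitVec, unitVec, real_inner_smul_left, real_inner_smul_right, mul_pow lam ‖x - y‖,
      norm_sub_sq_real]
    field_simp
    ring
  rw [h1, sqK, Real.sqrt_sq (by positivity), redK_zero, green, ← mul_div_assoc,
    mul_div_mul_left _ _ hlam.ne']

/-- The expansion of the Yukawa kernel in spherical harmonics. -/
theorem hasSum_kernelTerm {lam : ℝ} (hlam : 0 < lam) {x y : E3} (hy : y ≠ 0) (hyx : ‖y‖ < ‖x‖) :
    HasSum (kernelTerm lam x y) (green lam x y : ℂ) := by
  have hy0 : 0 < ‖y‖ := norm_pos_iff.2 hy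
  have hx : x ≠ 0 := norm_pos_iff.1 (hy0.trans hyx)
  have hsum : Summable (kernelTerm lam x y) :=
    Summable.of_norm_bounded (summable_kernelBound lam hy0 hyx)
      (norm_kernelTerm_le hlam hx hy le_rfl)
  have hu := norm_unitVec hx
  have hv := norm_unitVec hy
  have ht : inner ℝ (unitVec x) (unitVec y) ∈ Set.Icc (-1 : ℝ) 1 := by
    have := abs_real_inner_le_norm (unitVec x) (unitVec y)
    rw [hu, hv, mul_one] at this
    exact abs_le.1 this
  have h1 := (hasSum_yukawa_legendre (x := lam * ‖x‖) (y := lam * ‖y‖) (by positivity)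
    (mul_lt_mul_of_pos_left hyx hlam) ht).mul_left lam
  rw [← green_eq_sqK hlam hx hy, ← Complex.hasSum_ofReal] at h1
  rw [← indexEquiv.hasSum_iff]
  -- Summability over all `L` lets the sum be computed by degree; each finite inner sum is the
  -- addition theorem.
  refine HasSum.sigma_of_hasSum h1 (fun l => ?_) (indexEquiv.summable_iff.2 hsum)
  convert hasSum_fintype _ using 1
  have h2 := sum_sphericalHarmonic_mul_conj hu hv l
  rw [← Fin.sum_univ_eq_sum_range (fun k => sphericalHarmonic l ((k : ℤ) - l) (unitVec x) *
        (starRingEnd ℂ) (sphericalHarmonic l ((k : ℤ) - l) (unitVec y)))] at h2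
  have h3 : ∀ k : Fin (2 * l + 1), (kernelTerm lam x y ∘ indexEquiv) ⟨l, k⟩ =
      4 * (Real.pi : ℂ) * (lam : ℂ) * (besselI l (lam * ‖y‖) : ℂ) *
        (besselK l (lam * ‖x‖) : ℂ) * (sphericalHarmonic l (((k : ℕ) : ℤ) - l) (unitVec x) *
        (starRingEnd ℂ) (sphericalHarmonic l (((k : ℕ) : ℤ) - l) (unitVec y))) := by
    intro k
    simp only [Function.comp_apply, indexEquiv, Equiv.coe_fn_mk, kernelTerm]
    ring
  simp only [h3]
  rw [← Finset.mul_sum, h2]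
  have : (Real.pi : ℂ) ≠ 0 := by exact_mod_cast Real.pi_ne_zero
  push_cast
  field_simp

/-! ### Integration against the charge density. -/

lemma measurable_besselI (l : ℕ) : Measurable (besselI l) := by
  have h : Measurable (redI l) := by
    refine measurable_of_tendsto_metrizable (f := fun n y => ∑ s ∈ Finset.range n, redITerm l y s)
      (fun n => ?_) (tendsto_pi_nhds.2 fun y => (hasSum_redI l y).tendsto_sum_nat)
    unfold redITerm
    fun_prop
  have h2 : besselI l = fun y => y ^ l * redI l y := funext (besselI_eq l)
  rw [h2]
  fun_prop

lemma continuous_harmonicNonneg (l m : ℕ) : Continuous (harmonicNonneg l m) := by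
  unfold harmonicNonneg
  fun_prop

lemma measurable_sphericalHarmonic (l : ℕ) (m : ℤ) : Measurable (sphericalHarmonic l m) := by
  have h := (continuous_harmonicNonneg l m.natAbs).measurable
  unfold sphericalHarmonic
  split_ifs
  · exact h
  · exact (continuous_const.mul
      (Complex.continuous_conj.comp (continuous_harmonicNonneg l m.natAbs))).measurable

lemma measurable_unitVec : Measurable unitVec := by
  unfold unitVec
  fun_prop

/-- The weight of the modified multipole moments. -/
def momentWeight (lam : ℝ) (L : Index) (y : E3) : ℂ :=
  (besselI L.1.1 (lam * ‖y‖) : ℂ) *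
    (starRingEnd ℂ) (sphericalHarmonic L.1.1 L.1.2 (unitVec y))

lemma measurable_momentWeight (lam : ℝ) (L : Index) : Measurable (momentWeight lam L) := by
  have h1 := (measurable_besselI L.1.1).comp (measurable_norm.const_mul lam : Measurable
    fun y : E3 => lam * ‖y‖)
  have h2 := Complex.continuous_conj.measurable.comp
    ((measurable_sphericalHarmonic L.1.1 L.1.2).comp measurable_unitVec)
  exact (Complex.measurable_ofReal.comp h1).mul h2

/-- The origin is discarded because `unitVec 0` is not a unit vector, so the harmonic bounds and the
kernel expansion do not apply there. -/
lemma ae_restrict_closedBall (R : ℝ) :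
    ∀ᵐ y ∂(volume.restrict (closedBall (0 : E3) R)), y ≠ 0 ∧ ‖y‖ ≤ R := by
  have h1 : ∀ᵐ y ∂(volume.restrict (closedBall (0 : E3) R)), y ≠ 0 :=
    ae_restrict_of_ae (compl_mem_ae_iff.2 (measure_singleton 0))
  filter_upwards [h1, ae_restrict_mem measurableSet_closedBall] with y hy hyR
  exact ⟨hy, by simpa using hyR⟩

lemma IsLocalizedCharge.integrable_translate {τ : E3} {R : ℝ} {ρ : E3 → ℂ}
    (h : IsLocalizedCharge τ R ρ) : Integrable fun y => ρ (y + τ) :=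
  h.integrable.comp_add_right τ

lemma IsLocalizedCharge.translate_eq_zero {τ : E3} {R : ℝ} {ρ : E3 → ℂ}
    (h : IsLocalizedCharge τ R ρ) {y : E3} (hy : y ∉ closedBall (0 : E3) R) : ρ (y + τ) = 0 := by
  by_contra hne
  have := h.support_subset hne
  simp [mem_closedBall, dist_eq_norm] at this hy
  linarith

lemma integrableOn_momentIntegrand {lam R : ℝ} (hlam : 0 < lam) (hR : 0 < R) {τ : E3}
    {ρ : E3 → ℂ} (hρ : IsLocalizedCharge τ R ρ) (L : Index) :
    IntegrableOn (momentIntegrand lam τ ρ L) (closedBall (0 : E3) R) := by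
  have h := (hρ.integrable_translate.integrableOn (s := closedBall (0 : E3) R)).bdd_mul
    (f := momentWeight lam L)
    (c := Real.exp ((lam * R) ^ 2 / 2) * (lam * R) ^ L.1.1 / ((2 * L.1.1 + 1)‼ : ℝ) *
      Real.sqrt ((2 * L.1.1 + 1) / (4 * Real.pi)))
    (measurable_momentWeight lam L).aestronglyMeasurable (by
      filter_upwards [ae_restrict_closedBall R] with y hy
      rw [momentWeight, norm_mul, RCLike.norm_conj, Complex.norm_real, Real.norm_of_nonneg
        (besselI_nonneg _ (by positivity))]
      exact mul_le_mul (besselI_le _ (by positivity) (mul_le_mul_of_nonneg_left hy.2 hlam.le))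
        (norm_sphericalHarmonic_index_le (norm_unitVec hy.1) L) (norm_nonneg _) (by positivity))
  refine h.congr (Filter.Eventually.of_forall fun y => ?_)
  simp only [momentWeight, momentIntegrand]
  ring

lemma kernelTerm_mul (lam : ℝ) (τ x y : E3) (ρ : E3 → ℂ) (L : Index) :
    kernelTerm lam x y L * ρ (y + τ) = (4 * (Real.pi : ℂ) * (lam : ℂ) *
      (besselK L.1.1 (lam * ‖x‖) : ℂ) * sphericalHarmonic L.1.1 L.1.2 (unitVec x)) *
        momentIntegrand lam τ ρ L y := by
  rw [kernelTerm, momentIntegrand]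
  ring

lemma multipoleTerm_moment {lam : ℝ} (hlam : 0 < lam) (R : ℝ) (τ x : E3) (ρ : E3 → ℂ) (L : Index) :
    multipoleTerm lam (moment lam τ R ρ) x L =
      ∫ y in closedBall (0 : E3) R, kernelTerm lam x y L * ρ (y + τ) := by
  simp only [kernelTerm_mul]
  rw [integral_const_mul, multipoleTerm, moment]
  have h1 : (lam : ℂ) ≠ 0 := by exact_mod_cast hlam.ne'
  have h2 : ((2 * L.1.1 + 1)‼ : ℂ) ≠ 0 := by
    exact_mod_cast (Nat.doubleFactorial_pos _).ne'
  field_simp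
  ring

lemma integrableOn_potentialIntegrand {lam R : ℝ} (hlam : 0 < lam) {τ r : E3}
    {ρ : E3 → ℂ} (hρ : IsLocalizedCharge τ R ρ) (hr : R < ‖r - τ‖) :
    IntegrableOn (potentialIntegrand lam τ ρ r) (closedBall (0 : E3) R) := by
  have hm : Measurable fun y : E3 => (green lam (r - τ) y : ℂ) := by
    unfold green
    fun_prop
  refine (hρ.integrable_translate.integrableOn (s := closedBall (0 : E3) R)).bdd_mul
    (c := 1 / (‖r - τ‖ - R)) hm.aestronglyMeasurable ?_
  filter_upwards [ae_restrict_closedBall R] with y hy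
  -- The singularity of the kernel keeps this positive distance from the charge, so the kernel is
  -- bounded on the ball.
  have h1 : ‖r - τ‖ - R ≤ ‖r - τ - y‖ := by
    have := norm_sub_norm_le (r - τ) y
    linarith [hy.2]
  have h2 : 0 < ‖r - τ‖ - R := sub_pos.2 hr
  rw [Complex.norm_real, green, Real.norm_of_nonneg (by positivity)]
  refine div_le_div₀ zero_le_one (Real.exp_le_one_iff.2 ?_) h2 h1
  have : 0 ≤ lam * ‖r - τ - y‖ := by positivity
  linarith

lemma integrable_potentialIntegrand {lam R : ℝ} (hlam : 0 < lam) {τ r : E3}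
    {ρ : E3 → ℂ} (hρ : IsLocalizedCharge τ R ρ) (hr : R < ‖r - τ‖) :
    Integrable (potentialIntegrand lam τ ρ r) := by
  rw [← integrableOn_iff_integrable_of_support_subset (s := closedBall (0 : E3) R)]
  · exact integrableOn_potentialIntegrand hlam hρ hr
  · intro y hy
    by_contra hne
    exact hy (by simp [potentialIntegrand, hρ.translate_eq_zero hne])

theorem hasSum_multipoleTerm {lam R : ℝ} (hlam : 0 < lam) (hR : 0 < R) {τ r : E3}
    {ρ : E3 → ℂ} (hρ : IsLocalizedCharge τ R ρ) (hr : R < ‖r - τ‖) :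
    HasSum (multipoleTerm lam (moment lam τ R ρ) (r - τ)) (potential lam τ ρ r) := by
  have hx : r - τ ≠ 0 := norm_pos_iff.1 (hR.trans hr)
  have hint : ∀ L : Index, IntegrableOn (fun y => kernelTerm lam (r - τ) y L * ρ (y + τ))
      (closedBall (0 : E3) R) := by
    intro L
    simp only [kernelTerm_mul]
    exact (integrableOn_momentIntegrand hlam hR hρ L).const_mul _
  have hρi := hρ.integrable_translate.integrableOn (s := closedBall (0 : E3) R)
  -- Summability of the `L¹` norms is what allows exchanging sum and integral.
  have hsum : Summable fun L : Index =>
      ∫ y in closedBall (0 : E3) R, ‖kernelTerm lam (r - τ) y L * ρ (y + τ)‖ := by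
    refine Summable.of_nonneg_of_le (fun L => integral_nonneg fun y => norm_nonneg _) (fun L => ?_)
      ((summable_kernelBound lam hR hr).mul_right (∫ y in closedBall (0 : E3) R, ‖ρ (y + τ)‖))
    rw [← integral_const_mul]
    refine integral_mono_ae (hint L).norm (hρi.norm.const_mul _) ?_
    filter_upwards [ae_restrict_closedBall R] with y hy
    rw [norm_mul]
    exact mul_le_mul_of_nonneg_right (norm_kernelTerm_le hlam hx hy.1 hy.2 L) (norm_nonneg _)
  have h := hasSum_integral_of_summable_integral_norm hint hsum
  have hV : potential lam τ ρ r = ∫ y in closedBall (0 : E3) R,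
      ∑' L : Index, kernelTerm lam (r - τ) y L * ρ (y + τ) := by
    rw [potential, ← setIntegral_eq_integral_of_forall_compl_eq_zero (s := closedBall (0 : E3) R)
      fun y hy => by simp [potentialIntegrand, hρ.translate_eq_zero hy]]
    refine integral_congr_ae ?_
    filter_upwards [ae_restrict_closedBall R] with y hy
    exact ((hasSum_kernelTerm hlam hy.1 (hy.2.trans_lt hr)).mul_right _).tsum_eq.symm
  rw [hV, funext (multipoleTerm_moment hlam R τ (r - τ) ρ)]
  exact h

end Yukawa

end

theorem mainTheorem6 (lam R : ℝ) (hlam : 0 < lam) (hR : 0 < R) (τ : Yukawa.E3) :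
    (∀ ρ : Yukawa.E3 → ℂ, Yukawa.IsLocalizedCharge τ R ρ →
      (∀ L : Yukawa.Index,
        IntegrableOn (Yukawa.momentIntegrand lam τ ρ L) (closedBall (0 : Yukawa.E3) R)) ∧
      ∀ r : Yukawa.E3, r ∉ closedBall τ R →
        Integrable (Yukawa.potentialIntegrand lam τ ρ r) ∧
        HasSum (Yukawa.multipoleTerm lam (Yukawa.moment lam τ R ρ) (r - τ))
          (Yukawa.potential lam τ ρ r)) ∧
    (∀ ρ₁ ρ₂ : Yukawa.E3 → ℂ,
      Yukawa.IsLocalizedCharge τ R ρ₁ → Yukawa.IsLocalizedCharge τ R ρ₂ →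
      (∀ L : Yukawa.Index, Yukawa.moment lam τ R ρ₁ L = Yukawa.moment lam τ R ρ₂ L) →
      ∀ r : Yukawa.E3, r ∉ closedBall τ R →
        Yukawa.potential lam τ ρ₁ r = Yukawa.potential lam τ ρ₂ r) := by
  have hr : ∀ r : Yukawa.E3, r ∉ closedBall τ R → R < ‖r - τ‖ := fun r h => by
    simpa [mem_closedBall, dist_eq_norm] using h
  refine ⟨fun ρ hρ => ⟨Yukawa.integrableOn_momentIntegrand hlam hR hρ, fun r h =>
    ⟨Yukawa.integrable_potentialIntegrand hlam hρ (hr r h),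
      Yukawa.hasSum_multipoleTerm hlam hR hρ (hr r h)⟩⟩, fun ρ₁ ρ₂ h₁ h₂ hm r h => ?_⟩
  -- Equal moments give the same series, and sums are unique.
  have e₁ := Yukawa.hasSum_multipoleTerm hlam hR h₁ (hr r h)
  rw [funext hm] at e₁
  exact e₁.unique (Yukawa.hasSum_multipoleTerm hlam hR h₂ (hr r h))
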